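/- Let $d,m\ge 1$ be integers and let $\alpha_1\ge\alpha_2\ge\dots\ge\alpha_m$ be numbers in $(0,1]$ with $\alpha:=\alpha_m<1$. Let $F=(f_i)_{i=1}^m:\mathbb R^m\to\mathbb R^m$ be globally Lipschitz, with $f_i(0)=0$, $f_i\in C^1(\mathbb R^m)$ and $\partial_j f_i>0$ on $\mathbb R^m$ for all $j\ne i$. Assume that the principal (Perron–Frobenius) eigenvalue of $DF(0)$, that is, the eigenvalue of $DF(0)$ which has an eigenvector with positive entries, is positive, and that there is $\Lambda>1$ such that $f_i(s)\le 0$ for all $i$ and all $s\in\mathbb R^m$ with $s_j\ge\Lambda$ for every $j$. Let $\gamma_{mm}>0$ be a constant with $|\partial_m f_m(s)|\le\gamma_{mm}$ for all $s\in[0,\Lambda]^m$. Let $u_0=(u_{0i})_{i=1}^m$ be continuous on $\mathbb R^d$ with $u_{0i}\ge 0$ for all $i$, $u_0\not\equiv 0$ (at least one component is not identically zero), and $u_{0i}(x)=O(|x|^{-(d+2\alpha_i)})$ as $|x|\to\infty$ for all $i$. Let $u=(u_i)_{i=1}^m$ be the solution on $[0,\infty)$ of $$\partial_t u_i+(-\Delta)^{\alpha_i}u_i=f_i(u)\quad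 (t>0,\ x\in\mathbb R^d),\qquad u_i(0,\cdot)=u_{0i},$$ that is, $u\in C([0,\infty),L^2(\mathbb R^d)^m)\cap C\big((0,\infty),\prod_{i} H^{2\alpha_i}(\mathbb R^d)\big)$, $\partial_t u\in C((0,\infty),L^2(\mathbb R^d)^m)$, the equations hold in $L^2(\mathbb R^d)$ for every $t>0$ (with $(-\Delta)^{\alpha_i}$ the Fourier multiplier $|\xi|^{2\alpha_i}$), and $u_i(t,\cdot)$ denotes the continuous representative. Then there is a constant $\underline c>0$ such that for all $i\in\{1,\dots,m\}$, all $x\in\mathbb R^d$ and all $t\ge 1$, $$u_i(t,x)\ \ge\ \frac{\underline c\,t\,e^{-\gamma_{mm}t}}{t^{\frac{d}{2\alpha}+1}+|x|^{d+2\alpha}}.$$ -/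

import Mathlib

open MeasureTheory Filter Set
open scoped FourierTransform

noncomputable section

/-- Real-valued square integrable functions (classes) on `ℝ^d`. -/
abbrev RealL2 (d : ℕ) : Type :=
  Lp ℝ 2 (volume : Measure (EuclideanSpace ℝ (Fin d)))

/-- A real `L²` function seen as a complex `L²` function. -/
def complexify {d : ℕ} (w : RealL2 d) :
    Lp ℂ 2 (volume : Measure (EuclideanSpace ℝ (Fin d))) :=
  Complex.ofRealCLM.compLp w

/-- `w` belongs to `H^{2a}(ℝ^d)`, the domain of `(-Δ)^a` in `L²(ℝ^d)`, and `(-Δ)^a w = g`.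
Mathlib's Fourier transform uses the kernel `exp (-2πi ⟨x, ξ⟩)`, so the symbol of `(-Δ)^a` is
`(2π|ξ|)^{2a}`; for `a = 1` this is `-Δ`. -/
def IsFracLaplacian {d : ℕ} (a : ℝ) (w g : RealL2 d) : Prop :=
  ∀ᵐ ξ : EuclideanSpace ℝ (Fin d),
    (𝓕 (complexify g)) ξ
      = (((2 * Real.pi * ‖ξ‖) ^ (2 * a) : ℝ) : ℂ) * (𝓕 (complexify w)) ξ

/-- The partial derivative `∂_j g (s)` of a function on `ℝ^m`. -/
def partialD {m : ℕ} (j : Fin m) (g : (Fin m → ℝ) → ℝ) (s : Fin m → ℝ) : ℝ :=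
  fderiv ℝ g s (Pi.single j 1)

/-- The Jacobian matrix `DF(s) = (∂_j f_i(s))_{i,j}`. -/
def jacobian {m : ℕ} (f : Fin m → (Fin m → ℝ) → ℝ) (s : Fin m → ℝ) :
    Matrix (Fin m) (Fin m) ℝ :=
  Matrix.of fun i j => partialD j (f i) s

/-- The principal (Perron-Frobenius) eigenvalue of a matrix with positive off-diagonal entries:
the eigenvalue that has an eigenvector with positive entries. -/
def IsPrincipalEigenvalue {m : ℕ} (A : Matrix (Fin m) (Fin m) ℝ) (l : ℝ) : Prop :=
  ∃ φ : Fin m → ℝ, (∀ i, 0 < φ i) ∧ A.mulVec φ = l • φ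

/-- `u` is the (global) solution of the system
`∂_t u_i + (-Δ)^{α_i} u_i = f_i(u)` for `t > 0`, `u_i(0, ·) = u_{0i}`, in the `L²` semigroup sense:
`u ∈ C([0,∞), L²) ∩ C((0,∞), H^{2α_1} × ⋯ × H^{2α_m})`, `∂_t u ∈ C((0,∞), L²)`.
Here `U i t`, `V i t`, `A i t` are the `L²` classes of `u_i(t,·)`, `∂_t u_i(t,·)` and
`(-Δ)^{α_i} u_i(t,·)`, and `u i t` is the continuous representative of `U i t`. -/
structure IsSolution {d m : ℕ} (α : Fin m → ℝ) (f : Fin m → (Fin m → ℝ) → ℝ)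
    (u₀ : Fin m → EuclideanSpace ℝ (Fin d) → ℝ)
    (u : Fin m → ℝ → EuclideanSpace ℝ (Fin d) → ℝ) : Prop where
  initial : ∀ i, u i 0 = u₀ i
  continuous_space : ∀ i, ∀ t, 0 ≤ t → Continuous (u i t)
  strong : ∃ U V A : Fin m → ℝ → RealL2 d,
    (∀ i, ∀ t, 0 ≤ t → U i t =ᵐ[volume] u i t) ∧
    (∀ i, ContinuousOn (U i) (Ici 0)) ∧
    (∀ i, ContinuousOn (V i) (Ioi 0)) ∧
    (∀ i, ContinuousOn (A i) (Ioi 0)) ∧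
    (∀ i, ∀ t, 0 < t → HasDerivAt (U i) (V i t) t) ∧
    (∀ i, ∀ t, 0 < t → IsFracLaplacian (α i) (U i t) (A i t)) ∧
    (∀ i, ∀ t, 0 < t → ∀ᵐ x, V i t x + A i t x = f i (fun j => u j t x))

end

/-! The algebraic tail is produced by the long jumps of the last component, whose order `α < 1` is
the smallest. In weak form `(-Δ)^a` with `a < 1` is a superposition of symmetric differences `w -
(w(·+h) + w(·-h))/2` with weight `|h|^{-(d+2a)}` (`exists_integral_mul_eq_shiftForm`), and `-Δ` is a
limit of such differences (`tendsto_sum_shiftForm`). Every estimate on the operators thus reduces to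
an inequality for one difference, tested against the barrier `b_R = (R² + |x|²)^{-q/2}` with `q = d
+ 2α`. No heat kernel is needed.

Fix a final time `T ≥ 1` and put `R = T^{1/(2α)}`. Then `R^{-2α} = 1/T`, so at this scale diffusion
has rate `K/T` and costs only a constant factor `e^{-K}` up to time `T`.

Solutions are nonnegative (`IsStrongSolution.nonneg`), and at time `1/4` the last component carries
positive mass, by cooperativity (`IsStrongSolution.mass_pos`). Let `ψ` be a concave truncation of
the identity that is constant above `Λ`. The reaction is at least `-γ u_m` where `0 ≤ u_m ≤ Λ`, and
concavity lets `ψ` pass through the operator, so `∫ ψ(u_m) b_R` decays at rate at most `γ + K/T`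
(`exp_mul_mass_le`).

Jumps spread this mass: since `|h|^{-(d+2α)} ≥ b_R(h)`, wherever `u_m` lies below a multiple of
`b_R` it receives at least a constant times `R^q b_R(x) ∫ u_m b_R`
(`exists_integral_posPart_mul_le_scaled`). The mass is at least of order `R^{-q} e^{-γs}`, so the
powers of `R` cancel. Comparison with `κ(s) b_R`, `κ(s) = a₀ (s - 1/4) e^{-ρ(s - 1/4)}`, `ρ = γ +
K/T`, gives `u_m ≥ c T e^{-γT} b_R` on `[T - 1/2, T]` (`IsStrongSolution.exists_barrier_le_last`);
the factor `T` is the accumulated inflow. The coupling passes this bound to the other components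
during that half unit of time (`IsStrongSolution.exists_barrier_le_of_source`). Finally `R^q =
T^{d/(2α)+1}`. -/

noncomputable section

/-! ### Translations of `L²` functions and their Fourier transforms. -/

section Translation

open scoped RealInnerProductSpace

variable {E : Type*} [NormedAddCommGroup E] [InnerProductSpace ℝ E]

/-- The character `ξ ↦ e^{2πi⟨h, ξ⟩}`. -/
def phase (h ξ : E) : ℂ :=
  Complex.exp ((2 * Real.pi * ⟪h, ξ⟫ : ℝ) * Complex.I)

@[simp]
theorem norm_phase (h ξ : E) : ‖phase h ξ‖ = 1 :=
  Complex.norm_exp_ofReal_mul_I _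

theorem continuous_phase (h : E) : Continuous (phase h) := by
  unfold phase
  fun_prop

variable [FiniteDimensional ℝ E] [MeasurableSpace E] [BorelSpace E]

/-- Translation of `L²` functions, `(translateLp h w)(x) = w (x + h)`. -/
def translateLp {F : Type*} [NormedAddCommGroup F] (h : E) (w : Lp F 2 (volume : Measure E)) :
    Lp F 2 (volume : Measure E) :=
  Lp.compMeasurePreserving (fun x => x + h) (measurePreserving_add_right volume h) w

theorem coeFn_translate {F : Type*} [NormedAddCommGroup F] (h : E)
    (w : Lp F 2 (volume : Measure E)) : translateLp h w =ᵐ[volume] fun x => w (x + h) :=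
  Lp.coeFn_compMeasurePreserving w (measurePreserving_add_right volume h)

theorem continuous_translateLp {F : Type*} [NormedAddCommGroup F] (h : E) :
    Continuous (translateLp h : Lp F 2 (volume : Measure E) → Lp F 2 (volume : Measure E)) :=
  (Lp.isometry_compMeasurePreserving (measurePreserving_add_right volume h)).continuous

theorem memLp_char_mul (h : E) (w : Lp ℂ 2 (volume : Measure E)) :
    MemLp (fun ξ => phase h ξ * w ξ) 2 volume := by
  refine (Lp.memLp w).of_le ?_ (ae_of_all _ fun ξ => by simp)
  refine AEStronglyMeasurable.mul ?_ (Lp.aestronglyMeasurable w)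
  exact (continuous_phase h).aestronglyMeasurable

/-- Multiplication of an `L²` function by the character `ξ ↦ e^{2πi⟨h, ξ⟩}`. -/
def modulate (h : E) (w : Lp ℂ 2 (volume : Measure E)) : Lp ℂ 2 (volume : Measure E) :=
  (memLp_char_mul h w).toLp _

theorem coeFn_modulate (h : E) (w : Lp ℂ 2 (volume : Measure E)) :
    modulate h w =ᵐ[volume] fun ξ => phase h ξ * w ξ :=
  MemLp.coeFn_toLp _

theorem continuous_modulate (h : E) :
    Continuous (modulate h : Lp ℂ 2 (volume : Measure E) → Lp ℂ 2 (volume : Measure E)) := by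
  refine (LipschitzWith.of_dist_le_mul (K := 1) fun v w => ?_).continuous
  rw [NNReal.coe_one, one_mul, dist_eq_norm, dist_eq_norm]
  refine Lp.norm_le_norm_of_ae_le ?_
  filter_upwards [Lp.coeFn_sub (modulate h v) (modulate h w), Lp.coeFn_sub v w,
    coeFn_modulate h v, coeFn_modulate h w] with ξ h1 h2 h3 h4
  rw [h1, h2, Pi.sub_apply, Pi.sub_apply, h3, h4, ← mul_sub, norm_mul]
  simp

/-- Both sides are continuous in `w` on `L²`, so it suffices to check Schwartz functions, where the
Fourier transform is an honest integral. -/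
theorem fourier_translate (h : E) (w : Lp ℂ 2 (volume : Measure E)) :
    𝓕 (translateLp h w) = modulate h (𝓕 w) := by
  have hc : Continuous (𝓕 : Lp ℂ 2 (volume : Measure E) → Lp ℂ 2 (volume : Measure E)) :=
    (Lp.fourierTransformₗᵢ E ℂ).continuous
  refine congrFun ((SchwartzMap.denseRange_toLpCLM (E := E) (F := ℂ) (μ := volume) (p := 2)
    ENNReal.ofNat_ne_top).equalizer (g := fun w => 𝓕 (translateLp h w))
    (h := fun w => modulate h (𝓕 w)) (hc.comp (continuous_translateLp h))
    ((continuous_modulate h).comp hc) ?_) w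
  funext φ
  simp only [Function.comp_apply, SchwartzMap.toLpCLM_apply]
  have h1 : translateLp h (φ.toLp 2 volume) = (φ.compSubConstCLM ℝ (-h)).toLp 2 volume := by
    refine Lp.ext ?_
    have hq := (measurePreserving_add_right (volume : Measure E) h).quasiMeasurePreserving.ae_eq_comp
      (φ.coeFn_toLp 2 volume)
    filter_upwards [coeFn_translate h (φ.toLp 2 volume),
      (φ.compSubConstCLM ℝ (-h)).coeFn_toLp 2 volume, hq] with x h1 h2 h3
    rw [h1, h2, SchwartzMap.compSubConstCLM_apply, sub_neg_eq_add]
    exact h3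
  rw [h1, SchwartzMap.toLp_fourier_eq, SchwartzMap.toLp_fourier_eq]
  refine Lp.ext ?_
  filter_upwards [(𝓕 (φ.compSubConstCLM ℝ (-h))).coeFn_toLp 2 volume,
    (𝓕 φ).coeFn_toLp 2 volume, coeFn_modulate h ((𝓕 φ).toLp 2 volume)] with ξ h1 h2 h3
  rw [h1, h3, h2, SchwartzMap.fourier_coe, SchwartzMap.fourier_coe]
  have h4 := congrFun (VectorFourier.fourierIntegral_comp_add_right Real.fourierChar
    (volume : Measure E) (innerₗ E) (φ : E → ℂ) h) ξ
  have h5 : (⇑(φ.compSubConstCLM ℝ (-h)) : E → ℂ) = (φ : E → ℂ) ∘ fun v => v + h := by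
    funext x
    rw [SchwartzMap.compSubConstCLM_apply, sub_neg_eq_add]; rfl
  rw [h5]
  rw [show 𝓕 ((φ : E → ℂ) ∘ fun v => v + h) ξ = _ from h4, Circle.smul_def,
    Real.fourierChar_apply, phase, smul_eq_mul]
  rfl

/-- The bilinear form of the symmetric difference operator `w ↦ w - (τ_h w + τ_{-h} w) / 2`. -/
def shiftForm (h : E) (p w : E → ℝ) : ℝ :=
  ∫ x, p x * (w x - (w (x + h) + w (x - h)) / 2)

end Translation

/-! ### The symmetric difference form on the Fourier side. -/

section FourierForm

variable {d : ℕ}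

open scoped RealInnerProductSpace

theorem coeFn_complexify (w : RealL2 d) :
    complexify w =ᵐ[volume] fun x => ((w x : ℝ) : ℂ) :=
  ContinuousLinearMap.coeFn_compLp _ _

theorem inner_complexify (p w : RealL2 d) :
    inner ℂ (complexify p) (complexify w) = ((∫ x, p x * w x : ℝ) : ℂ) := by
  rw [L2.inner_def, ← integral_complex_ofReal]
  refine integral_congr_ae ?_
  filter_upwards [coeFn_complexify p, coeFn_complexify w] with x h1 h2
  rw [h1, h2]
  simp [mul_comm]

theorem translate_complexify (h : EuclideanSpace ℝ (Fin d)) (w : RealL2 d) :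
    translateLp h (complexify w) = complexify (translateLp h w) := by
  refine Lp.ext ?_
  have hq := (measurePreserving_add_right (volume : Measure (EuclideanSpace ℝ (Fin d)))
    h).quasiMeasurePreserving.ae_eq_comp (coeFn_complexify w)
  filter_upwards [coeFn_translate h (complexify w), coeFn_complexify (translateLp h w),
    coeFn_translate h w, hq] with x h1 h2 h3 h4
  rw [h1, h2, h3]
  exact h4

/-- The product `conj (p̂) ŵ` of the Fourier transforms of two real `L²` functions. -/
def fourierProd (p w : RealL2 d) (ξ : EuclideanSpace ℝ (Fin d)) : ℝ :=
  (inner ℂ ((𝓕 (complexify p)) ξ) ((𝓕 (complexify w)) ξ)).re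

theorem integrable_fourierProd (p w : RealL2 d) : Integrable (fourierProd p w) volume :=
  (L2.integrable_inner (𝕜 := ℂ) (𝓕 (complexify p)) (𝓕 (complexify w))).re

theorem integral_mul_eq_fourierProd (p w : RealL2 d) :
    ∫ x, p x * w x = ∫ ξ, fourierProd p w ξ := by
  have h := inner_complexify p w
  rw [← Lp.inner_fourier_eq, L2.inner_def] at h
  have h2 := congrArg Complex.re h
  rw [Complex.ofReal_re] at h2
  rw [← h2]
  exact (integral_re (L2.integrable_inner (𝕜 := ℂ) (𝓕 (complexify p)) (𝓕 (complexify w)))).symm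

theorem integral_mul_translate (h : EuclideanSpace ℝ (Fin d)) (p w : RealL2 d) :
    ∫ x, p x * w (x + h) = ∫ ξ, (phase h ξ *
      inner ℂ ((𝓕 (complexify p)) ξ) ((𝓕 (complexify w)) ξ)).re := by
  have h1 : ∫ x, p x * w (x + h) = ∫ x, p x * translateLp h w x := by
    refine integral_congr_ae ?_
    filter_upwards [coeFn_translate h w] with x hx
    rw [hx]
  rw [h1, integral_mul_eq_fourierProd]
  refine integral_congr_ae ?_
  filter_upwards [coeFn_modulate h (𝓕 (complexify w))] with ξ hξ
  rw [fourierProd, ← translate_complexify, fourier_translate, hξ]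
  simp only [RCLike.inner_apply]
  ring_nf

theorem integrable_mul_shift (h : EuclideanSpace ℝ (Fin d)) {p w : EuclideanSpace ℝ (Fin d) → ℝ}
    (hp : MemLp p 2 volume) (hw : MemLp w 2 volume) :
    Integrable (fun x => p x * w (x + h)) volume :=
  hp.integrable_mul (hw.comp_measurePreserving (measurePreserving_add_right volume h))

theorem shiftForm_eq {p w : EuclideanSpace ℝ (Fin d) → ℝ} (hp : MemLp p 2 volume)
    (hw : MemLp w 2 volume) (h : EuclideanSpace ℝ (Fin d)) :
    shiftForm h p w = (∫ x, p x * w x) - ((∫ x, p x * w (x + h)) + ∫ x, p x * w (x - h)) / 2 := by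
  have i0 : Integrable (fun x => p x * w x) volume := hp.integrable_mul hw
  have i1 := integrable_mul_shift h hp hw
  have i2 : Integrable (fun x => p x * w (x - h)) volume := by
    simpa only [sub_eq_add_neg] using integrable_mul_shift (-h) hp hw
  rw [← integral_add i1 i2, ← integral_div, shiftForm]
  refine Eq.trans ?_ (integral_sub i0 ((i1.add i2).div_const 2))
  congr 1
  ext x
  ring

/-- Plancherel: shifts by `h` and `-h` multiply `ŵ` by conjugate phases, whose average is the
cosine. -/
theorem shiftForm_eq_fourier (h : EuclideanSpace ℝ (Fin d)) (p w : RealL2 d) :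
    shiftForm h p w = ∫ ξ, (1 - Real.cos (2 * Real.pi * ⟪h, ξ⟫)) * fourierProd p w ξ := by
  have hI := L2.integrable_inner (𝕜 := ℂ) (𝓕 (complexify p)) (𝓕 (complexify w))
  have key : ∀ k : EuclideanSpace ℝ (Fin d), Integrable (fun ξ => (phase k ξ *
      inner ℂ ((𝓕 (complexify p)) ξ) ((𝓕 (complexify w)) ξ)).re) volume := by
    intro k
    exact (hI.bdd_mul (c := 1) (f := phase k) (continuous_phase k).aestronglyMeasurable
      (ae_of_all _ fun ξ => (norm_phase k ξ).le)).re
  have e2 : ∫ x, p x * w (x - h) = ∫ x, p x * w (x + -h) := by simp only [sub_eq_add_neg]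
  rw [shiftForm_eq (Lp.memLp p) (Lp.memLp w), e2, integral_mul_translate, integral_mul_translate,
    integral_mul_eq_fourierProd, ← integral_add (key h) (key (-h)), ← integral_div]
  refine ((integral_sub (integrable_fourierProd p w)
    (((key h).add (key (-h))).div_const 2))).symm.trans ?_
  congr 1
  ext ξ
  simp only [fourierProd, Complex.mul_re, phase, inner_neg_left, Complex.exp_ofReal_mul_I_re,
    Complex.exp_ofReal_mul_I_im, mul_neg, Real.cos_neg, Real.sin_neg, Pi.add_apply]
  ring

end FourierForm

/-! ### The fractional Laplacian as an integral or a limit of symmetric differences. -/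

section Kernel

open scoped RealInnerProductSpace

variable {d : ℕ}

/-- The kernel `|h|^{-(d + 2a)}` of the fractional Laplacian of order `2a`. -/
def fracKernel (a : ℝ) (h : EuclideanSpace ℝ (Fin d)) : ℝ :=
  ‖h‖ ^ (-((d : ℝ) + 2 * a))

theorem fracKernel_nonneg (a : ℝ) (h : EuclideanSpace ℝ (Fin d)) : 0 ≤ fracKernel a h :=
  Real.rpow_nonneg (norm_nonneg h) _

theorem measurable_fracKernel (a : ℝ) :
    Measurable (fracKernel a : EuclideanSpace ℝ (Fin d) → ℝ) :=
  measurable_norm.pow_const _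

theorem integrable_min_mul_fracKernel (hd : 1 ≤ d) {a : ℝ} (ha : 0 < a) (ha1 : a < 1) :
    Integrable (fun h : EuclideanSpace ℝ (Fin d) => min 1 (‖h‖ ^ 2) * fracKernel a h) volume := by
  have : NeZero d := ⟨by omega⟩
  have : Nontrivial (EuclideanSpace ℝ (Fin d)) := by
    have : Nonempty (Fin d) := ⟨⟨0, by omega⟩⟩
    infer_instance
  refine (integrable_fun_norm_addHaar volume
    (f := fun r : ℝ => min 1 (r ^ 2) * r ^ (-((d : ℝ) + 2 * a)))).2 ?_
  rw [finrank_euclideanSpace_fin, ← Ioc_union_Ioi_eq_Ioi zero_le_one]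
  have hpow : ∀ r : ℝ, 0 < r → r ^ (d - 1) = r ^ ((d : ℝ) - 1) := by
    intro r hr
    rw [← Real.rpow_natCast, Nat.cast_sub hd, Nat.cast_one]
  -- With the radial Jacobian the integrand is `r^(1-2a)` on `(0, 1]`, integrable because `a < 1`,
  -- and `r^(-1-2a)` beyond `1`, integrable because `a > 0`.
  refine IntegrableOn.union ?_ ?_
  · have h1 : IntegrableOn (fun r : ℝ => r ^ (1 - 2 * a)) (Ioc 0 1) volume :=
      (intervalIntegrable_iff_integrableOn_Ioc_of_le zero_le_one).1
        (intervalIntegral.intervalIntegrable_rpow' (by linarith))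
    refine h1.congr_fun (fun r hr => ?_) measurableSet_Ioc
    have hr0 : 0 < r := hr.1
    have hr1 : r ^ 2 ≤ 1 := pow_le_one₀ hr0.le hr.2
    simp only [smul_eq_mul]
    rw [min_eq_right hr1, hpow r hr0, ← Real.rpow_natCast r 2, ← Real.rpow_add hr0,
      ← Real.rpow_add hr0]
    congr 1
    push_cast
    ring
  · have h1 : IntegrableOn (fun r : ℝ => r ^ (-1 - 2 * a)) (Ioi 1) volume :=
      integrableOn_Ioi_rpow_of_lt (by linarith) zero_lt_one
    refine h1.congr_fun (fun r hr => ?_) measurableSet_Ioi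
    have hr1 : (1 : ℝ) < r := hr
    have hr0 : 0 < r := by linarith
    simp only [smul_eq_mul]
    rw [min_eq_left (one_le_pow₀ hr1.le), hpow r hr0, one_mul, ← Real.rpow_add hr0]
    congr 1
    ring

theorem integral_comp_smul_mul_fracKernel (F : EuclideanSpace ℝ (Fin d) → ℝ) (a : ℝ) {r : ℝ}
    (hr : 0 < r) :
    ∫ h, F (r • h) * fracKernel a h = r ^ (2 * a) * ∫ h, F h * fracKernel a h := by
  have h1 := Measure.integral_comp_smul (volume : Measure (EuclideanSpace ℝ (Fin d)))
    (fun h => F h * fracKernel a h) r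
  have h2 : ∀ h : EuclideanSpace ℝ (Fin d), F (r • h) * fracKernel a (r • h)
      = r ^ (-((d : ℝ) + 2 * a)) * (F (r • h) * fracKernel a h) := by
    intro h
    rw [fracKernel, fracKernel, norm_smul, Real.norm_of_nonneg hr.le,
      Real.mul_rpow hr.le (norm_nonneg h)]
    ring
  simp_rw [h2] at h1
  rw [integral_const_mul, finrank_euclideanSpace_fin, abs_of_pos (by positivity), smul_eq_mul] at h1
  have h3 : r ^ (-((d : ℝ) + 2 * a)) * r ^ (2 * a) = (r ^ d)⁻¹ := by
    rw [← Real.rpow_add hr, ← Real.rpow_natCast, ← Real.rpow_neg hr.le]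
    congr 1
    ring
  have h4 : r ^ (-((d : ℝ) + 2 * a)) ≠ 0 := (Real.rpow_pos_of_pos hr _).ne'
  refine mul_left_cancel₀ h4 ?_
  rw [h1, ← mul_assoc, h3]

theorem integrable_one_sub_cos_mul_fracKernel (hd : 1 ≤ d) {a : ℝ} (ha : 0 < a) (ha1 : a < 1)
    (ξ : EuclideanSpace ℝ (Fin d)) :
    Integrable (fun h => (1 - Real.cos (2 * Real.pi * ⟪h, ξ⟫)) * fracKernel a h) volume := by
  set C : ℝ := 2 + (2 * Real.pi * ‖ξ‖) ^ 2 with hC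
  refine ((integrable_min_mul_fracKernel hd ha ha1).const_mul C).mono' ?_ (ae_of_all _ fun h => ?_)
  · refine Measurable.aestronglyMeasurable (Measurable.mul ?_ (measurable_fracKernel a))
    exact Continuous.measurable (by fun_prop)
  · have hcos := Real.cos_le_one (2 * Real.pi * ⟪h, ξ⟫)
    have hcos' := Real.neg_one_le_cos (2 * Real.pi * ⟪h, ξ⟫)
    have hcos2 := Real.one_sub_sq_div_two_le_cos (x := 2 * Real.pi * ⟪h, ξ⟫)
    have hin : (2 * Real.pi * ⟪h, ξ⟫) ^ 2 ≤ (2 * Real.pi * ‖ξ‖) ^ 2 * ‖h‖ ^ 2 := by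
      have h1 := sq_le_sq' (abs_le.1 (abs_real_inner_le_norm h ξ)).1
        (abs_le.1 (abs_real_inner_le_norm h ξ)).2
      calc (2 * Real.pi * ⟪h, ξ⟫) ^ 2 = (2 * Real.pi) ^ 2 * ⟪h, ξ⟫ ^ 2 := by ring
        _ ≤ (2 * Real.pi) ^ 2 * (‖h‖ * ‖ξ‖) ^ 2 := by gcongr
        _ = (2 * Real.pi * ‖ξ‖) ^ 2 * ‖h‖ ^ 2 := by ring
    rw [Real.norm_eq_abs, abs_of_nonneg (mul_nonneg (by linarith) (fracKernel_nonneg a h)),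
      ← mul_assoc]
    refine mul_le_mul_of_nonneg_right ?_ (fracKernel_nonneg a h)
    rcases le_total 1 (‖h‖ ^ 2) with h1 | h1
    · rw [min_eq_left h1]
      nlinarith [sq_nonneg (2 * Real.pi * ‖ξ‖)]
    · rw [min_eq_right h1]
      nlinarith [sq_nonneg (2 * Real.pi * ‖ξ‖), sq_nonneg ‖h‖]

/-- The symbol `∫ (1 - cos 2π⟨h, ξ⟩) |h|^{-(d + 2a)} dh`. -/
def fracSymbol (a : ℝ) (ξ : EuclideanSpace ℝ (Fin d)) : ℝ :=
  ∫ h, (1 - Real.cos (2 * Real.pi * ⟪h, ξ⟫)) * fracKernel a h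

theorem fracSymbol_smul (a : ℝ) {r : ℝ} (hr : 0 < r) (ξ : EuclideanSpace ℝ (Fin d)) :
    fracSymbol a (r • ξ) = r ^ (2 * a) * fracSymbol a ξ := by
  rw [fracSymbol, fracSymbol, ← integral_comp_smul_mul_fracKernel _ a hr]
  simp only [inner_smul_left, inner_smul_right]
  rfl

theorem fracSymbol_eq_of_norm_eq (a : ℝ) {ξ η : EuclideanSpace ℝ (Fin d)} (h : ‖ξ‖ = ‖η‖) :
    fracSymbol a ξ = fracSymbol a η := by
  set O := (ℝ ∙ (ξ - η))ᗮ.reflection with hO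
  have hOξ : O ξ = η := Submodule.reflection_sub h
  have h1 := (O.measurePreserving).integral_comp O.toHomeomorph.measurableEmbedding
    (fun h => (1 - Real.cos (2 * Real.pi * ⟪h, η⟫)) * fracKernel a h)
  rw [fracSymbol, fracSymbol, ← h1]
  congr 1
  ext k
  rw [← hOξ, LinearIsometryEquiv.inner_map_map, fracKernel, fracKernel, LinearIsometryEquiv.norm_map]

/-- The symbol is homogeneous of degree `2a` and invariant under reflections, hence a multiple of
`‖ξ‖^(2a)`. The multiple is positive because the nonnegative integrand does not vanish near `h =
e/2`, where the cosine is `-1`. -/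
theorem exists_fracSymbol_eq (hd : 1 ≤ d) {a : ℝ} (ha : 0 < a) (ha1 : a < 1) :
    ∃ c : ℝ, 0 < c ∧ ∀ ξ : EuclideanSpace ℝ (Fin d),
      (2 * Real.pi * ‖ξ‖) ^ (2 * a) = c * fracSymbol a ξ := by
  set e : EuclideanSpace ℝ (Fin d) := EuclideanSpace.single ⟨0, by omega⟩ 1 with he
  have hnorm : ‖e‖ = 1 := by simp [he]
  have hpos : 0 < fracSymbol a e := by
    have hnn : ∀ h : EuclideanSpace ℝ (Fin d), 0 ≤ 1 - Real.cos (2 * Real.pi * ⟪h, e⟫) :=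
      fun h => by linarith [Real.cos_le_one (2 * Real.pi * ⟪h, e⟫)]
    rw [fracSymbol, integral_pos_iff_support_of_nonneg
      (fun h => mul_nonneg (hnn h) (fracKernel_nonneg a h))
      (integrable_one_sub_cos_mul_fracKernel hd ha ha1 e)]
    have hopen : IsOpen {h : EuclideanSpace ℝ (Fin d) | 1 - Real.cos (2 * Real.pi * ⟪h, e⟫) ≠ 0} :=
      isOpen_ne_fun (by fun_prop) continuous_const
    refine (hopen.measure_pos volume ⟨(1 / 2 : ℝ) • e, ?_⟩).trans_le (measure_mono fun h hh => ?_)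
    · rw [mem_ofPred_eq, inner_smul_left, real_inner_self_eq_norm_sq, hnorm]
      have : 2 * Real.pi * ((starRingEnd ℝ) (1 / 2 : ℝ) * 1 ^ 2) = Real.pi := by
        simp
        ring
      rw [this, Real.cos_pi]
      norm_num
    · refine mul_ne_zero hh ?_
      have h0 : h ≠ 0 := by
        rintro rfl
        simp at hh
      exact (Real.rpow_pos_of_pos (norm_pos_iff.2 h0) _).ne'
  refine ⟨(2 * Real.pi) ^ (2 * a) / fracSymbol a e, by positivity, fun ξ => ?_⟩
  have h2 : fracSymbol a ξ = ‖ξ‖ ^ (2 * a) * fracSymbol a e := by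
    rcases eq_or_ne ξ 0 with rfl | hξ
    · rw [norm_zero, Real.zero_rpow (by linarith)]
      simp [fracSymbol]
    · rw [← fracSymbol_smul a (norm_pos_iff.2 hξ)]
      exact fracSymbol_eq_of_norm_eq a (by rw [norm_smul, hnorm]; simp)
  rw [h2, Real.mul_rpow (by positivity) (norm_nonneg ξ)]
  field_simp

theorem fourierProd_of_isFracLaplacian {a : ℝ} {w g : RealL2 d} (h : IsFracLaplacian a w g)
    (p : RealL2 d) :
    ∀ᵐ ξ, fourierProd p g ξ = (2 * Real.pi * ‖ξ‖) ^ (2 * a) * fourierProd p w ξ := by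
  filter_upwards [h] with ξ hξ
  rw [fourierProd, hξ, ← smul_eq_mul, inner_smul_right, Complex.re_ofReal_mul, fourierProd]

/-- Fubini for the integrand in `(h, ξ)`. Integrating over `ξ` first gives the difference form;
integrating over `h` first gives the symbol. -/
theorem exists_integral_mul_eq_shiftForm (hd : 1 ≤ d) {a : ℝ} (ha : 0 < a) (ha1 : a < 1) :
    ∃ c : ℝ, 0 < c ∧ ∀ w g p : RealL2 d, IsFracLaplacian a w g →
      Integrable (fun h => shiftForm h p w * fracKernel a h) volume ∧
      ∫ x, p x * g x = c * ∫ h, shiftForm h p w * fracKernel a h := by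
  obtain ⟨c, hc, hsymb⟩ := exists_fracSymbol_eq hd ha ha1
  refine ⟨c, hc, fun w g p hwg => ?_⟩
  have hgp := fourierProd_of_isFracLaplacian hwg p
  set G : EuclideanSpace ℝ (Fin d) × EuclideanSpace ℝ (Fin d) → ℝ := fun z =>
    (1 - Real.cos (2 * Real.pi * ⟪z.1, z.2⟫)) * fracKernel a z.1 * fourierProd p w z.2 with hG
  have hGm : AEStronglyMeasurable G (volume.prod volume) := by
    refine AEStronglyMeasurable.mul (Measurable.aestronglyMeasurable ?_)
      (integrable_fourierProd p w).aestronglyMeasurable.comp_snd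
    refine Measurable.mul (Continuous.measurable (by fun_prop)) ((measurable_fracKernel a).comp measurable_fst)
  have hin : ∀ ξ, ∫ h, (1 - Real.cos (2 * Real.pi * ⟪h, ξ⟫)) * fracKernel a h * fourierProd p w ξ
      = fracSymbol a ξ * fourierProd p w ξ := fun ξ => integral_mul_const _ _
  have hcg : ∀ᵐ ξ, fracSymbol a ξ * fourierProd p w ξ = c⁻¹ * fourierProd p g ξ := by
    filter_upwards [hgp] with ξ hξ
    rw [hξ, hsymb]
    field_simp
  -- As `(1 - cos)` times the kernel is nonnegative, the `h`-integral of `|G|` is the symbol times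
  -- `|fourierProd p w|`, that is `c⁻¹ |fourierProd p g|`, which is integrable.
  have hGi : Integrable G (volume.prod volume) := by
    refine (integrable_prod_iff' hGm).2 ⟨ae_of_all _ fun ξ =>
      (integrable_one_sub_cos_mul_fracKernel hd ha ha1 ξ).mul_const (fourierProd p w ξ), ?_⟩
    refine (((integrable_fourierProd p g).norm.const_mul c⁻¹)).congr ?_
    filter_upwards [hcg] with ξ hξ
    have hnn : ∀ h : EuclideanSpace ℝ (Fin d), 0 ≤
        (1 - Real.cos (2 * Real.pi * ⟪h, ξ⟫)) * fracKernel a h := fun h =>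
      mul_nonneg (by linarith [Real.cos_le_one (2 * Real.pi * ⟪h, ξ⟫)]) (fracKernel_nonneg a h)
    have h1 : ∀ h : EuclideanSpace ℝ (Fin d), ‖G (h, ξ)‖ =
        (1 - Real.cos (2 * Real.pi * ⟪h, ξ⟫)) * fracKernel a h * ‖fourierProd p w ξ‖ := fun h => by
      rw [hG, norm_mul, Real.norm_of_nonneg (hnn h)]
    simp_rw [h1]
    rw [integral_mul_const]
    have h2 := congrArg norm hξ
    rw [norm_mul, norm_mul, Real.norm_of_nonneg (inv_pos.2 hc).le] at h2
    rw [← h2, fracSymbol, Real.norm_of_nonneg (integral_nonneg hnn)]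
  have hform : ∀ h, ∫ ξ, G (h, ξ) = shiftForm h p w * fracKernel a h := by
    intro h
    rw [shiftForm_eq_fourier, ← integral_mul_const]
    congr 1
    ext ξ
    rw [hG]
    ring
  refine ⟨?_, ?_⟩
  · have := hGi.integral_prod_left
    simpa only [hform] using this
  · have h1 := integral_integral_swap (f := fun h ξ => G (h, ξ)) hGi
    simp_rw [hform] at h1
    rw [h1]
    have h2 : ∫ ξ, ∫ h, G (h, ξ) = ∫ ξ, c⁻¹ * fourierProd p g ξ := by
      refine integral_congr_ae ?_
      filter_upwards [hcg] with ξ hξ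
      rw [← hξ]
      exact hin ξ
    rw [h2, integral_const_mul, integral_mul_eq_fourierProd]
    field_simp

theorem two_div_sq_mul_one_sub_cos_le {ε : ℝ} (hε : 0 < ε) (y : ℝ) :
    2 / ε ^ 2 * (1 - Real.cos (ε * y)) ≤ y ^ 2 := by
  have h := Real.one_sub_sq_div_two_le_cos (x := ε * y)
  rw [div_mul_eq_mul_div, div_le_iff₀ (by positivity)]
  nlinarith

theorem tendsto_two_div_sq_mul_one_sub_cos (y : ℝ) :
    Tendsto (fun n : ℕ => 2 / (1 / ((n : ℝ) + 1)) ^ 2 * (1 - Real.cos (1 / ((n : ℝ) + 1) * y)))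
      atTop (nhds (y ^ 2)) := by
  have h0 := tendsto_one_div_add_atTop_nhds_zero_nat (𝕜 := ℝ)
  have h1 : Tendsto (fun n : ℕ => (1 / ((n : ℝ) + 1)) ^ 2 * (y ^ 4)) atTop (nhds 0) := by
    have := (h0.pow 2).mul_const (y ^ 4)
    simpa using this
  rw [tendsto_iff_norm_sub_tendsto_zero]
  refine squeeze_zero' (Eventually.of_forall fun n => norm_nonneg _) ?_ h1
  have h2 : ∀ᶠ n : ℕ in atTop, |1 / ((n : ℝ) + 1) * y| ≤ 1 := by
    have h3 : Tendsto (fun n : ℕ => |1 / ((n : ℝ) + 1) * y|) atTop (nhds 0) := by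
      have := (h0.mul_const y).abs
      simpa using this
    exact (h3.eventually (gt_mem_nhds zero_lt_one)).mono fun n hn => hn.le
  filter_upwards [h2] with n hn
  set ε : ℝ := 1 / ((n : ℝ) + 1) with hε
  have hεpos : 0 < ε := by positivity
  have hb := Real.cos_bound hn
  have e1 : 2 / ε ^ 2 * (1 - Real.cos (ε * y)) - y ^ 2
      = -(2 / ε ^ 2) * (Real.cos (ε * y) - (1 - (ε * y) ^ 2 / 2)) := by
    field_simp
    ring
  rw [e1, norm_mul, norm_neg, Real.norm_of_nonneg (by positivity), Real.norm_eq_abs]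
  calc 2 / ε ^ 2 * |Real.cos (ε * y) - (1 - (ε * y) ^ 2 / 2)|
      ≤ 2 / ε ^ 2 * (|ε * y| ^ 4 * (5 / 96)) := by gcongr
    _ = ε ^ 2 * y ^ 4 * (10 / 96) := by
        rw [show |ε * y| ^ 4 = (ε * y) ^ 4 from (by norm_num : Even 4).pow_abs _]
        field_simp
        ring
    _ ≤ ε ^ 2 * y ^ 4 := by nlinarith [show 0 ≤ ε ^ 2 * y ^ 4 by positivity]

/-- Second difference quotients in the coordinate directions. On the Fourier side `2 ε⁻² (1 - cos (ε
y))` increases no further than its limit `y²`, so `|fourierProd p g|` dominates. -/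
theorem tendsto_sum_shiftForm {w g : RealL2 d} (hwg : IsFracLaplacian 1 w g) (p : RealL2 d) :
    Tendsto (fun n : ℕ => ∑ j : Fin d, 2 / (1 / ((n : ℝ) + 1)) ^ 2 *
      shiftForm ((1 / ((n : ℝ) + 1)) • EuclideanSpace.single j (1 : ℝ)) p w) atTop
      (nhds (∫ x, p x * g x)) := by
  have hgp := fourierProd_of_isFracLaplacian hwg p
  set S : ℕ → EuclideanSpace ℝ (Fin d) → ℝ := fun n ξ => ∑ j : Fin d,
    2 / (1 / ((n : ℝ) + 1)) ^ 2 * (1 - Real.cos (1 / ((n : ℝ) + 1) * (2 * Real.pi * ξ j))) with hS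
  have hin : ∀ (n : ℕ) (j : Fin d) (ξ : EuclideanSpace ℝ (Fin d)),
      2 * Real.pi * ⟪(1 / ((n : ℝ) + 1)) • EuclideanSpace.single j (1 : ℝ), ξ⟫
        = 1 / ((n : ℝ) + 1) * (2 * Real.pi * ξ j) := by
    intro n j ξ
    rw [inner_smul_left, EuclideanSpace.inner_single_left]
    simp
    ring
  have hsq : ∀ ξ : EuclideanSpace ℝ (Fin d),
      ∑ j, (2 * Real.pi * ξ j) ^ 2 = (2 * Real.pi * ‖ξ‖) ^ (2 * (1 : ℝ)) := by
    intro ξ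
    rw [mul_one, show (2 : ℝ) = ((2 : ℕ) : ℝ) from rfl, Real.rpow_natCast, mul_pow,
      EuclideanSpace.real_norm_sq_eq, Finset.mul_sum]
    simp_rw [mul_pow]
  have hint : ∀ (n : ℕ) (j : Fin d), Integrable (fun ξ : EuclideanSpace ℝ (Fin d) =>
      2 / (1 / ((n : ℝ) + 1)) ^ 2 * ((1 - Real.cos (1 / ((n : ℝ) + 1) * (2 * Real.pi * ξ j))) *
        fourierProd p w ξ)) volume := by
    intro n j
    refine ((integrable_fourierProd p w).bdd_mul (c := 2) ?_ (ae_of_all _ fun ξ => ?_)).const_mul _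
    · exact Continuous.aestronglyMeasurable (by fun_prop)
    · rw [Real.norm_eq_abs, abs_le]
      constructor <;> linarith [Real.cos_le_one (1 / ((n : ℝ) + 1) * (2 * Real.pi * ξ j)),
        Real.neg_one_le_cos (1 / ((n : ℝ) + 1) * (2 * Real.pi * ξ j))]
  have heq : ∀ n : ℕ, ∑ j : Fin d, 2 / (1 / ((n : ℝ) + 1)) ^ 2 *
      shiftForm ((1 / ((n : ℝ) + 1)) • EuclideanSpace.single j (1 : ℝ)) p w
      = ∫ ξ, S n ξ * fourierProd p w ξ := by
    intro n
    simp_rw [shiftForm_eq_fourier, hin, ← integral_const_mul]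
    rw [← integral_finsetSum _ fun j _ => hint n j]
    congr 1
    ext ξ
    rw [hS, Finset.sum_mul]
    exact Finset.sum_congr rfl fun j _ => by ring
  simp_rw [heq]
  rw [integral_mul_eq_fourierProd]
  refine tendsto_integral_of_dominated_convergence (fun ξ => ‖fourierProd p g ξ‖)
    (fun n => ?_) (integrable_fourierProd p g).norm (fun n => ?_) ?_
  · refine AEStronglyMeasurable.mul (Continuous.aestronglyMeasurable ?_)
      (integrable_fourierProd p w).aestronglyMeasurable
    rw [hS]
    fun_prop
  · filter_upwards [hgp] with ξ hξ
    rw [hξ, norm_mul, norm_mul]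
    refine mul_le_mul_of_nonneg_right ?_ (norm_nonneg _)
    have hnn : 0 ≤ S n ξ := Finset.sum_nonneg fun j _ => mul_nonneg (by positivity)
      (by linarith [Real.cos_le_one (1 / ((n : ℝ) + 1) * (2 * Real.pi * ξ j))])
    rw [Real.norm_of_nonneg hnn, ← hsq, Real.norm_of_nonneg (Finset.sum_nonneg fun j _ => sq_nonneg _)]
    exact Finset.sum_le_sum fun j _ => two_div_sq_mul_one_sub_cos_le (by positivity) _
  · filter_upwards [hgp] with ξ hξ
    rw [hξ, ← hsq]
    exact (tendsto_finsetSum _ fun j _ => tendsto_two_div_sq_mul_one_sub_cos _).mul_const _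

/-- Puts the nonlocal case and `a = 1` under one roof: a bound on single differences is all that
later estimates have to supply. For `a = 1` each of the `d` directions contributes at most `2Y`. -/
theorem exists_integral_mul_le_of_shiftForm_le (hd : 1 ≤ d) {a : ℝ} (ha : 0 < a) (ha1 : a ≤ 1) :
    ∃ K : ℝ, 0 ≤ K ∧ ∀ w g p : RealL2 d, IsFracLaplacian a w g → ∀ Y : ℝ,
      (∀ h, shiftForm h p w ≤ min 1 (‖h‖ ^ 2) * Y) → ∫ x, p x * g x ≤ K * Y := by
  rcases ha1.lt_or_eq with ha1 | rfl
  · obtain ⟨c, hc, H⟩ := exists_integral_mul_eq_shiftForm hd ha ha1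
    refine ⟨c * ∫ h : EuclideanSpace ℝ (Fin d), min 1 (‖h‖ ^ 2) * fracKernel a h, ?_, ?_⟩
    · exact mul_nonneg hc.le (integral_nonneg fun h =>
        mul_nonneg (by positivity) (fracKernel_nonneg a h))
    · intro w g p hwg Y hY
      obtain ⟨hi, he⟩ := H w g p hwg
      rw [he, mul_assoc, ← integral_mul_const]
      refine mul_le_mul_of_nonneg_left ?_ hc.le
      refine integral_mono hi ((integrable_min_mul_fracKernel hd ha ha1).mul_const Y) fun h => ?_
      have := mul_le_mul_of_nonneg_right (hY h) (fracKernel_nonneg a h)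
      simp only
      linarith
  · refine ⟨2 * d, by positivity, fun w g p hwg Y hY => ?_⟩
    refine le_of_tendsto (tendsto_sum_shiftForm hwg p) (Eventually.of_forall fun n => ?_)
    have h1 : ∀ j : Fin d, 2 / (1 / ((n : ℝ) + 1)) ^ 2 *
        shiftForm ((1 / ((n : ℝ) + 1)) • EuclideanSpace.single j (1 : ℝ)) p w ≤ 2 * Y := by
      intro j
      have h2 := hY ((1 / ((n : ℝ) + 1)) • EuclideanSpace.single j (1 : ℝ))
      have hε : 0 < 1 / ((n : ℝ) + 1) := by positivity
      have hε1 : 1 / ((n : ℝ) + 1) ≤ 1 := by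
        rw [div_le_one (by positivity)]
        linarith [(Nat.cast_nonneg n : (0 : ℝ) ≤ n)]
      rw [norm_smul, PiLp.norm_single, norm_one, mul_one, Real.norm_of_nonneg hε.le,
        min_eq_right (pow_le_one₀ hε.le hε1)] at h2
      rw [div_mul_eq_mul_div, div_le_iff₀ (by positivity)]
      linarith
    refine (Finset.sum_le_sum fun j _ => h1 j).trans ?_
    simp
    linarith

end Kernel

/-! ### The barrier `(R² + |x|²)^{-q/2}`: differences, products and scaling. -/

section Barrier

variable {d : ℕ}

/-- The barrier function `(R² + |x|²)^{-q/2}`. -/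
def barrier (q R : ℝ) (x : EuclideanSpace ℝ (Fin d)) : ℝ :=
  (R ^ 2 + ‖x‖ ^ 2) ^ (-q / 2)

theorem barrier_pos (q : ℝ) {R : ℝ} (hR : 0 < R) (x : EuclideanSpace ℝ (Fin d)) :
    0 < barrier q R x :=
  Real.rpow_pos_of_pos (by positivity) _

theorem continuous_barrier (q : ℝ) {R : ℝ} (hR : 0 < R) :
    Continuous (barrier q R : EuclideanSpace ℝ (Fin d) → ℝ) := by
  unfold barrier
  refine Continuous.rpow_const (by fun_prop) fun x => Or.inl ?_
  positivity

theorem barrier_neg (q R : ℝ) (x : EuclideanSpace ℝ (Fin d)) : barrier q R (-x) = barrier q R x := by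
  rw [barrier, barrier, norm_neg]

theorem barrier_anti {q : ℝ} (hq : 0 ≤ q) {R : ℝ} (hR : 1 ≤ R) (x : EuclideanSpace ℝ (Fin d)) :
    barrier q R x ≤ barrier q 1 x := by
  refine Real.rpow_le_rpow_of_nonpos (by positivity) ?_ (by linarith)
  have : (1 : ℝ) ^ 2 ≤ R ^ 2 := by gcongr
  linarith

theorem barrier_le_one {q : ℝ} (hq : 0 ≤ q) {R : ℝ} (hR : 1 ≤ R) (x : EuclideanSpace ℝ (Fin d)) :
    barrier q R x ≤ 1 := by
  refine Real.rpow_le_one_of_one_le_of_nonpos ?_ (by linarith)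
  nlinarith [sq_nonneg ‖x‖]

theorem barrier_ge {q : ℝ} (hq : 0 ≤ q) {R : ℝ} (hR : 1 ≤ R) (x : EuclideanSpace ℝ (Fin d)) :
    R ^ (-q) * barrier q 1 x ≤ barrier q R x := by
  have hR0 : 0 < R := by linarith
  have h1 : R ^ (-q) = (R ^ 2) ^ (-q / 2) := by
    rw [← Real.rpow_natCast R 2, ← Real.rpow_mul hR0.le]
    congr 1
    push_cast
    ring
  rw [h1, barrier, barrier, ← Real.mul_rpow (by positivity) (by positivity)]
  refine Real.rpow_le_rpow_of_nonpos (by positivity) ?_ (by linarith)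
  have : (1 : ℝ) ≤ R ^ 2 := one_le_pow₀ hR
  nlinarith [sq_nonneg ‖x‖]

theorem barrier_one_eq (q : ℝ) (x : EuclideanSpace ℝ (Fin d)) :
    barrier q 1 x = (1 + ‖x‖ ^ 2) ^ (-q / 2) := by
  rw [barrier, one_pow]

theorem integrable_barrier_one {q : ℝ} (hq : (d : ℝ) < q) :
    Integrable (barrier q 1 : EuclideanSpace ℝ (Fin d) → ℝ) volume := by
  have h := integrable_rpow_neg_one_add_norm_sq
    (μ := (volume : Measure (EuclideanSpace ℝ (Fin d)))) (r := q) (by simpa using hq)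
  exact h.congr (ae_of_all _ fun x => (barrier_one_eq q x).symm)

theorem integrable_barrier {q R : ℝ} (hq : (d : ℝ) < q) (hR : 1 ≤ R) :
    Integrable (barrier q R : EuclideanSpace ℝ (Fin d) → ℝ) volume := by
  have hq0 : 0 ≤ q := (Nat.cast_nonneg d).trans hq.le
  refine (integrable_barrier_one hq).mono'
    (continuous_barrier q (by linarith)).aestronglyMeasurable (ae_of_all _ fun x => ?_)
  rw [Real.norm_of_nonneg (barrier_pos q (by linarith) x).le]
  exact barrier_anti hq0 hR x

theorem memLp_barrier {q R : ℝ} (hq : (d : ℝ) < q) (hR : 1 ≤ R) :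
    MemLp (barrier q R : EuclideanSpace ℝ (Fin d) → ℝ) 2 volume := by
  have hq0 : 0 ≤ q := (Nat.cast_nonneg d).trans hq.le
  have hm := (continuous_barrier (d := d) q (R := R) (by linarith)).aestronglyMeasurable
    (μ := (volume : Measure (EuclideanSpace ℝ (Fin d))))
  rw [memLp_two_iff_integrable_sq hm]
  refine (integrable_barrier hq hR).mono' (hm.pow 2) (ae_of_all _ fun x => ?_)
  have h0 := (barrier_pos q (R := R) (by linarith) x).le
  rw [Real.norm_of_nonneg (by positivity), sq]
  exact mul_le_of_le_one_left h0 (barrier_le_one hq0 hR x)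

theorem one_sub_mul_le_rpow_neg {p y : ℝ} (hp : 0 ≤ p) (hy : -1 < y) :
    1 - p * y ≤ (1 + y) ^ (-p) := by
  have h1 : 0 < 1 + y := by linarith
  rw [Real.rpow_def_of_pos h1]
  have h2 := Real.add_one_le_exp (Real.log (1 + y) * -p)
  have h3 := Real.log_le_sub_one_of_pos h1
  nlinarith

/-- The relative decay of the barrier under the symmetric difference operator. -/
def shiftRate (q R : ℝ) (h : EuclideanSpace ℝ (Fin d)) : ℝ :=
  min 1 (q / 2 * (‖h‖ ^ 2 / R ^ 2))

theorem shiftRate_nonneg {q : ℝ} (hq : 0 ≤ q) (R : ℝ) (h : EuclideanSpace ℝ (Fin d)) :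
    0 ≤ shiftRate q R h :=
  le_min zero_le_one (by positivity)

/-- The bound by `1` drops the positive shifted values. For the other, `y ↦ y^(-q/2)` is convex,
hence above its tangent at `m = R² + ‖x‖²`, and by the parallelogram law the two shifted arguments
average to `m + ‖h‖²`. -/
theorem barrier_sub_le {q R : ℝ} (hq : 0 ≤ q) (hR : 0 < R) (h x : EuclideanSpace ℝ (Fin d)) :
    barrier q R x - (barrier q R (x + h) + barrier q R (x - h)) / 2
      ≤ shiftRate q R h * barrier q R x := by
  have hb := barrier_pos q hR x
  rw [shiftRate, min_mul_of_nonneg _ _ hb.le]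
  refine le_min ?_ ?_
  · linarith [barrier_pos q hR (x + h), barrier_pos q hR (x - h)]
  · set m : ℝ := R ^ 2 + ‖x‖ ^ 2 with hm
    have hm0 : 0 < m := by positivity
    have key : ∀ y : EuclideanSpace ℝ (Fin d),
        barrier q R x * (1 - q / 2 * ((R ^ 2 + ‖y‖ ^ 2) / m - 1)) ≤ barrier q R y := by
      intro y
      have hy : 0 < R ^ 2 + ‖y‖ ^ 2 := by positivity
      have h1 := one_sub_mul_le_rpow_neg (p := q / 2) (y := (R ^ 2 + ‖y‖ ^ 2) / m - 1)
        (by positivity) (by linarith [div_pos hy hm0])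
      have h2 : barrier q R y = barrier q R x * (1 + ((R ^ 2 + ‖y‖ ^ 2) / m - 1)) ^ (-(q / 2)) := by
        rw [barrier, barrier, ← hm, ← neg_div, ← Real.mul_rpow hm0.le (by rw [add_sub_cancel]; positivity)]
        congr 1
        field_simp
        ring
      rw [h2]
      exact mul_le_mul_of_nonneg_left h1 hb.le
    have hpar := parallelogram_law_with_norm ℝ x h
    have k1 := key (x + h)
    have k2 := key (x - h)
    have e1 : (R ^ 2 + ‖x + h‖ ^ 2) / m - 1 + ((R ^ 2 + ‖x - h‖ ^ 2) / m - 1) = 2 * (‖h‖ ^ 2 / m) := by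
      field_simp
      linarith
    have e2 : ‖h‖ ^ 2 / m ≤ ‖h‖ ^ 2 / R ^ 2 := by
      gcongr
      rw [hm]
      linarith [sq_nonneg ‖x‖]
    have e3 : q / 2 * (‖h‖ ^ 2 / m) * barrier q R x ≤ q / 2 * (‖h‖ ^ 2 / R ^ 2) * barrier q R x := by
      gcongr
    have e4 : barrier q R x * (1 - q / 2 * ((R ^ 2 + ‖x + h‖ ^ 2) / m - 1))
        + barrier q R x * (1 - q / 2 * ((R ^ 2 + ‖x - h‖ ^ 2) / m - 1))
        = 2 * barrier q R x - 2 * (q / 2 * (‖h‖ ^ 2 / m) * barrier q R x) := by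
      linear_combination (-(barrier q R x) * (q / 2)) * e1
    linarith

theorem shiftRate_le {q R : ℝ} (hR : 1 ≤ R) (h : EuclideanSpace ℝ (Fin d)) :
    shiftRate q R h ≤ max 1 (q / 2) * min 1 (‖h‖ ^ 2) := by
  have hM1 : 1 ≤ max 1 (q / 2) := le_max_left _ _
  have hR2 : ‖h‖ ^ 2 / R ^ 2 ≤ ‖h‖ ^ 2 := div_le_self (by positivity) (one_le_pow₀ hR)
  rw [shiftRate, mul_min_of_nonneg _ _ (by linarith)]
  refine min_le_min (by linarith) ?_
  calc q / 2 * (‖h‖ ^ 2 / R ^ 2) ≤ max 1 (q / 2) * (‖h‖ ^ 2 / R ^ 2) := by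
        gcongr
        exact le_max_right _ _
    _ ≤ max 1 (q / 2) * ‖h‖ ^ 2 := by gcongr

/-- It comes from `R² + ‖z - x‖² ≤ 2 R⁻² (R² + ‖x‖²)(R² + ‖z‖²)`. Separating the variables turns the
mass arriving at `x` into `b_R(x)` times a weighted total mass. -/
theorem barrier_mul_le {q R : ℝ} (hq : 0 ≤ q) (hR : 0 < R) (x z : EuclideanSpace ℝ (Fin d)) :
    2 ^ (-q / 2) * R ^ q * barrier q R x * barrier q R z ≤ barrier q R (z - x) := by
  have h1 : R ^ q = (R ^ 2)⁻¹ ^ (-q / 2) := by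
    rw [Real.inv_rpow (by positivity), ← Real.rpow_neg (by positivity), ← Real.rpow_natCast R 2,
      ← Real.rpow_mul hR.le]
    congr 1
    push_cast
    ring
  rw [h1, barrier, barrier, barrier, ← Real.mul_rpow (by positivity) (by positivity),
    ← Real.mul_rpow (by positivity) (by positivity), ← Real.mul_rpow (by positivity) (by positivity)]
  refine Real.rpow_le_rpow_of_nonpos (by positivity) ?_ (by linarith)
  have h2 : ‖z - x‖ ^ 2 ≤ 2 * (‖z‖ ^ 2 + ‖x‖ ^ 2) := by
    have := parallelogram_law_with_norm ℝ z x
    linarith [sq_nonneg ‖z + x‖]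
  have h3 : 2 * (R ^ 2)⁻¹ * (R ^ 2 + ‖x‖ ^ 2) * (R ^ 2 + ‖z‖ ^ 2)
      = 2 * (R ^ 2 + ‖x‖ ^ 2 + ‖z‖ ^ 2) + 2 * (R ^ 2)⁻¹ * (‖x‖ ^ 2 * ‖z‖ ^ 2) := by
    field_simp
    ring
  rw [h3]
  have h4 : 0 ≤ 2 * (R ^ 2)⁻¹ * (‖x‖ ^ 2 * ‖z‖ ^ 2) := by positivity
  nlinarith [sq_nonneg R]

theorem barrier_le_fracKernel (hd : 1 ≤ d) {a R : ℝ} (ha : 0 < a) {h : EuclideanSpace ℝ (Fin d)}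
    (hh : h ≠ 0) : barrier ((d : ℝ) + 2 * a) R h ≤ fracKernel a h := by
  have hn : 0 < ‖h‖ := norm_pos_iff.2 hh
  have h1 : fracKernel a h = (‖h‖ ^ 2) ^ (-((d : ℝ) + 2 * a) / 2) := by
    rw [fracKernel, ← Real.rpow_natCast ‖h‖ 2, ← Real.rpow_mul hn.le]
    congr 1
    push_cast
    ring
  rw [h1, barrier]
  refine Real.rpow_le_rpow_of_nonpos (by positivity) (by linarith [sq_nonneg R]) ?_
  have : (0 : ℝ) < d := by exact_mod_cast hd
  linarith

theorem integral_barrier (a : ℝ) {R : ℝ} (hR : 0 < R) :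
    ∫ h : EuclideanSpace ℝ (Fin d), barrier ((d : ℝ) + 2 * a) R h
      = R ^ (-(2 * a)) * ∫ h : EuclideanSpace ℝ (Fin d), barrier ((d : ℝ) + 2 * a) 1 h := by
  have h1 := Measure.integral_comp_smul (volume : Measure (EuclideanSpace ℝ (Fin d)))
    (fun h => barrier ((d : ℝ) + 2 * a) R h) R
  have h2 : ∀ h : EuclideanSpace ℝ (Fin d), barrier ((d : ℝ) + 2 * a) R (R • h)
      = R ^ (-((d : ℝ) + 2 * a)) * barrier ((d : ℝ) + 2 * a) 1 h := by
    intro h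
    have e1 : R ^ (-((d : ℝ) + 2 * a)) = (R ^ 2) ^ (-((d : ℝ) + 2 * a) / 2) := by
      rw [← Real.rpow_natCast R 2, ← Real.rpow_mul hR.le]
      congr 1
      push_cast
      ring
    rw [e1, barrier, barrier, ← Real.mul_rpow (by positivity) (by positivity), norm_smul,
      Real.norm_of_nonneg hR.le]
    congr 1
    ring
  simp_rw [h2] at h1
  rw [integral_const_mul, finrank_euclideanSpace_fin, abs_of_pos (by positivity), smul_eq_mul] at h1
  have h3 : (R ^ d)⁻¹ * R ^ (-(2 * a)) = R ^ (-((d : ℝ) + 2 * a)) := by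
    rw [← Real.rpow_natCast, ← Real.rpow_neg hR.le, ← Real.rpow_add hR]
    congr 1
    ring
  have h4 : (R ^ d)⁻¹ ≠ 0 := by positivity
  refine mul_left_cancel₀ h4 ?_
  rw [← h1, ← mul_assoc, h3]

theorem shiftRate_smul (q R : ℝ) (h : EuclideanSpace ℝ (Fin d)) :
    shiftRate q R h = shiftRate q 1 (R⁻¹ • h) := by
  rw [shiftRate, shiftRate, norm_smul, mul_pow, one_pow, div_one, norm_inv, inv_pow,
    Real.norm_eq_abs, sq_abs, div_eq_inv_mul (‖h‖ ^ 2)]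

/-- The source of the diffusive rate `R^(-2a)`, which is `1/T` at `R = T^(1/(2a))`. -/
theorem integral_shiftRate_mul_fracKernel (q a : ℝ) {R : ℝ} (hR : 0 < R) :
    ∫ h : EuclideanSpace ℝ (Fin d), shiftRate q R h * fracKernel a h
      = R ^ (-(2 * a)) * ∫ h : EuclideanSpace ℝ (Fin d), shiftRate q 1 h * fracKernel a h := by
  simp_rw [shiftRate_smul q R]
  rw [integral_comp_smul_mul_fracKernel _ a (inv_pos.2 hR), Real.inv_rpow hR.le, Real.rpow_neg hR.le]

theorem integrable_shiftRate_mul_fracKernel (hd : 1 ≤ d) {a q R : ℝ} (ha : 0 < a) (ha1 : a < 1)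
    (hq : 0 ≤ q) (hR : 1 ≤ R) :
    Integrable (fun h : EuclideanSpace ℝ (Fin d) => shiftRate q R h * fracKernel a h) volume := by
  refine ((integrable_min_mul_fracKernel hd ha ha1).const_mul (max 1 (q / 2))).mono' ?_
    (ae_of_all _ fun h => ?_)
  · refine Measurable.aestronglyMeasurable (Measurable.mul ?_ (measurable_fracKernel a))
    unfold shiftRate
    exact Continuous.measurable (by fun_prop)
  · rw [Real.norm_of_nonneg (mul_nonneg (shiftRate_nonneg hq R h) (fracKernel_nonneg a h)),
      ← mul_assoc]
    exact mul_le_mul_of_nonneg_right (shiftRate_le hR h) (fracKernel_nonneg a h)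

theorem inv_le_barrier {q R : ℝ} (hq : 0 ≤ q) (hR : 0 < R) (x : EuclideanSpace ℝ (Fin d)) :
    2 ^ (-q / 2) / (R ^ q + ‖x‖ ^ q) ≤ barrier q R x := by
  have hpos : 0 < R ^ q + ‖x‖ ^ q := by positivity
  have hB : 0 < R ^ 2 + ‖x‖ ^ 2 := by positivity
  have e : ∀ s : ℝ, 0 ≤ s → s ^ q = (s ^ 2) ^ (q / 2) := by
    intro s hs
    rw [← Real.rpow_natCast s 2, ← Real.rpow_mul hs]
    congr 1
    push_cast
    ring
  rw [barrier, neg_div, Real.rpow_neg hB.le, Real.rpow_neg zero_le_two, div_eq_mul_inv, ← mul_inv]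
  refine inv_anti₀ (by positivity) ?_
  have h1 : R ^ 2 + ‖x‖ ^ 2 ≤ 2 * max (R ^ 2) (‖x‖ ^ 2) := by
    linarith [le_max_left (R ^ 2) (‖x‖ ^ 2), le_max_right (R ^ 2) (‖x‖ ^ 2)]
  refine (Real.rpow_le_rpow hB.le h1 (by positivity)).trans ?_
  rw [Real.mul_rpow zero_le_two (by positivity)]
  refine mul_le_mul_of_nonneg_left ?_ (by positivity)
  rw [e R hR.le, e ‖x‖ (norm_nonneg x)]
  rcases max_choice (R ^ 2) (‖x‖ ^ 2) with h | h <;> rw [h]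
  · linarith [Real.rpow_nonneg (sq_nonneg ‖x‖) (q / 2)]
  · linarith [Real.rpow_nonneg (sq_nonneg R) (q / 2)]

end Barrier

/-! ### Positivity, comparison and concavity inequalities for one difference. -/

section FormInequalities

variable {d : ℕ}

theorem integrable_mul_shift_sub {p w : EuclideanSpace ℝ (Fin d) → ℝ}
    (hp : MemLp p 2 volume) (hw : MemLp w 2 volume) (h : EuclideanSpace ℝ (Fin d)) :
    Integrable (fun x => p x * w (x - h)) volume := by
  simpa only [sub_eq_add_neg] using integrable_mul_shift (-h) hp hw

theorem integrable_shiftForm {p w : EuclideanSpace ℝ (Fin d) → ℝ}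
    (hp : MemLp p 2 volume) (hw : MemLp w 2 volume) (h : EuclideanSpace ℝ (Fin d)) :
    Integrable (fun x => p x * (w x - (w (x + h) + w (x - h)) / 2)) volume := by
  have i0 : Integrable (fun x => p x * w x) volume := hp.integrable_mul hw
  refine (i0.sub (((integrable_mul_shift h hp hw).add
    (integrable_mul_shift_sub hp hw h)).div_const 2)).congr (ae_of_all _ fun x => ?_)
  simp only [Pi.sub_apply, Pi.add_apply]
  ring

theorem ae_shift {P : EuclideanSpace ℝ (Fin d) → Prop} (hP : ∀ᵐ x, P x)
    (h : EuclideanSpace ℝ (Fin d)) : ∀ᵐ x, P (x + h) :=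
  (measurePreserving_add_right (volume : Measure (EuclideanSpace ℝ (Fin d)))
    h).quasiMeasurePreserving.ae hP

theorem ae_shift_sub {P : EuclideanSpace ℝ (Fin d) → Prop} (hP : ∀ᵐ x, P x)
    (h : EuclideanSpace ℝ (Fin d)) : ∀ᵐ x, P (x - h) := by
  simpa only [sub_eq_add_neg] using ae_shift hP (-h)

theorem shiftForm_congr_ae {p p' w w' : EuclideanSpace ℝ (Fin d) → ℝ} (hp : p =ᵐ[volume] p')
    (hw : w =ᵐ[volume] w') (h : EuclideanSpace ℝ (Fin d)) :
    shiftForm h p w = shiftForm h p' w' := by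
  refine integral_congr_ae ?_
  filter_upwards [hp, hw, ae_shift hw h, ae_shift_sub hw h] with x h1 h2 h3 h4
  rw [h1, h2, h3, h4]

theorem shiftForm_comm {p w : EuclideanSpace ℝ (Fin d) → ℝ}
    (hp : MemLp p 2 volume) (hw : MemLp w 2 volume) (h : EuclideanSpace ℝ (Fin d)) :
    shiftForm h p w = shiftForm h w p := by
  have e1 : ∫ x, w x * p (x - h) = ∫ x, p x * w (x + h) := by
    rw [← integral_add_right_eq_self (fun x => w x * p (x - h)) h]
    simp only [add_sub_cancel_right, mul_comm]
  have e2 : ∫ x, w x * p (x + h) = ∫ x, p x * w (x - h) := by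
    rw [← integral_sub_right_eq_self (fun x => w x * p (x + h)) h]
    simp only [sub_add_cancel, mul_comm]
  rw [shiftForm_eq hp hw, shiftForm_eq hw hp, e1, e2, add_comm]
  simp only [mul_comm]

/-- Beurling–Deny for a single shift: `v⁺ v(·+k) ≤ v⁺ v⁺(·+k)`, and by the inequality of means and
translation invariance the latter integrates to at most `∫ (v⁺)² = ∫ v⁺ v`. -/
theorem shiftForm_posPart_nonneg {v : EuclideanSpace ℝ (Fin d) → ℝ} (hv : MemLp v 2 volume)
    (h : EuclideanSpace ℝ (Fin d)) : 0 ≤ shiftForm h (fun x => max (v x) 0) v := by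
  have hp : MemLp (fun x => max (v x) 0) 2 volume := hv.pos_part
  have hsq : Integrable (fun x => max (v x) 0 ^ 2) volume := hp.integrable_sq
  have key : ∀ k : EuclideanSpace ℝ (Fin d),
      ∫ x, max (v x) 0 * v (x + k) ≤ ∫ x, max (v x) 0 ^ 2 := by
    intro k
    have hk : Integrable (fun x => max (v (x + k)) 0 ^ 2) volume := hsq.comp_add_right k
    have e : ∫ x, max (v (x + k)) 0 ^ 2 = ∫ x, max (v x) 0 ^ 2 :=
      integral_add_right_eq_self (fun x => max (v x) 0 ^ 2) k
    have h1 : ∫ x, max (v x) 0 * v (x + k)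
        ≤ ∫ x, (max (v x) 0 ^ 2 + max (v (x + k)) 0 ^ 2) / 2 := by
      refine integral_mono (integrable_mul_shift k hp hv) ((hsq.add hk).div_const 2) fun x => ?_
      simp only
      have h2 : max (v x) 0 * v (x + k) ≤ max (v x) 0 * max (v (x + k)) 0 :=
        mul_le_mul_of_nonneg_left (le_max_left _ _) (le_max_right _ _)
      nlinarith [sq_nonneg (max (v x) 0 - max (v (x + k)) 0)]
    rw [integral_div, integral_add hsq hk, e] at h1
    linarith
  have k2 := key (-h)
  simp only [← sub_eq_add_neg] at k2
  rw [shiftForm_eq hp hv]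
  have e0 : ∫ x, max (v x) 0 * v x = ∫ x, max (v x) 0 ^ 2 := by
    congr 1
    ext x
    rcases le_total (v x) 0 with h0 | h0
    · simp [h0]
    · rw [max_eq_left h0, sq]
  rw [e0]
  linarith [key h]

theorem shiftForm_le_of_sub_le {U W : EuclideanSpace ℝ (Fin d) → ℝ} (hU : MemLp U 2 volume)
    (hW : MemLp W 2 volume) {θ : ℝ} {h : EuclideanSpace ℝ (Fin d)}
    (hθ : ∀ x, W x - (W (x + h) + W (x - h)) / 2 ≤ θ * W x) :
    shiftForm h (fun x => max (W x - U x) 0) U ≤ θ * ∫ x, max (W x - U x) 0 * W x := by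
  have hv : MemLp (fun x => W x - U x) 2 volume := hW.sub hU
  have hp : MemLp (fun x => max (W x - U x) 0) 2 volume := hv.pos_part
  have h1 := shiftForm_posPart_nonneg hv h
  have h2 : shiftForm h (fun x => max (W x - U x) 0) (fun x => W x - U x)
      = shiftForm h (fun x => max (W x - U x) 0) W - shiftForm h (fun x => max (W x - U x) 0) U := by
    simp only [shiftForm]
    rw [← integral_sub (integrable_shiftForm hp hW h) (integrable_shiftForm hp hU h)]
    congr 1
    ext x
    ring
  have h3 : shiftForm h (fun x => max (W x - U x) 0) W ≤ ∫ x, θ * (max (W x - U x) 0 * W x) := by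
    have i0 : Integrable (fun x => max (W x - U x) 0 * W x) volume := hp.integrable_mul hW
    refine integral_mono (integrable_shiftForm hp hW h) (i0.const_mul θ) fun x => ?_
    have := mul_le_mul_of_nonneg_left (hθ x) (le_max_right (W x - U x) 0)
    simp only
    linarith
  rw [integral_const_mul] at h3
  linarith

/-- Concavity gives `ψ'(U)` times the difference of `U` at most the difference of `ψ(U)`. Symmetry
of the form then moves the difference onto `b`. -/
theorem shiftForm_concave_le {U b : EuclideanSpace ℝ (Fin d) → ℝ} {ψ ψ' : ℝ → ℝ}
    (hU : MemLp U 2 volume) (hb : MemLp b 2 volume) (hψ : ∀ s t, ψ t ≤ ψ s + ψ' s * (t - s))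
    (hψU : MemLp (fun x => ψ (U x)) 2 volume) (hψ0 : ∀ᵐ x, 0 ≤ ψ (U x))
    (hψ'U : MemLp (fun x => ψ' (U x) * b x) 2 volume) (hb0 : ∀ x, 0 ≤ b x)
    {θ : ℝ} {h : EuclideanSpace ℝ (Fin d)}
    (hθ : ∀ x, b x - (b (x + h) + b (x - h)) / 2 ≤ θ * b x) :
    shiftForm h (fun x => ψ' (U x) * b x) U ≤ θ * ∫ x, ψ (U x) * b x := by
  calc shiftForm h (fun x => ψ' (U x) * b x) U ≤ shiftForm h b (fun x => ψ (U x)) := by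
        refine integral_mono (integrable_shiftForm hψ'U hU h) (integrable_shiftForm hb hψU h)
          fun x => ?_
        have h1 := hψ (U x) (U (x + h))
        have h2 := hψ (U x) (U (x - h))
        simp only
        have h3 : ψ' (U x) * (U x - (U (x + h) + U (x - h)) / 2)
            ≤ ψ (U x) - (ψ (U (x + h)) + ψ (U (x - h))) / 2 := by linarith
        linarith [mul_le_mul_of_nonneg_left h3 (hb0 x)]
    _ = shiftForm h (fun x => ψ (U x)) b := shiftForm_comm hb hψU h
    _ ≤ ∫ x, θ * (ψ (U x) * b x) := by
        have i0 : Integrable (fun x => ψ (U x) * b x) volume := hψU.integrable_mul hb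
        refine integral_mono_ae (integrable_shiftForm hψU hb h) (i0.const_mul θ) ?_
        filter_upwards [hψ0] with x hx
        linarith [mul_le_mul_of_nonneg_left (hθ x) hx]
    _ = θ * ∫ x, ψ (U x) * b x := integral_const_mul _ _

end FormInequalities

/-! ### Weak bounds for the fractional Laplacian against the barrier. -/

section Operator

variable {d : ℕ}

theorem barrier_const_mul_sub_le {q R κ : ℝ} (hq : 0 ≤ q) (hR : 0 < R) (hκ : 0 ≤ κ)
    (h x : EuclideanSpace ℝ (Fin d)) :
    κ * barrier q R x - (κ * barrier q R (x + h) + κ * barrier q R (x - h)) / 2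
      ≤ shiftRate q R h * (κ * barrier q R x) := by
  linarith [mul_le_mul_of_nonneg_left (barrier_sub_le hq hR h x) hκ]

theorem shiftForm_toLp {p : EuclideanSpace ℝ (Fin d) → ℝ} (hp : MemLp p 2 volume) (w : RealL2 d)
    (h : EuclideanSpace ℝ (Fin d)) : shiftForm h (hp.toLp p) w = shiftForm h p w :=
  shiftForm_congr_ae hp.coeFn_toLp (EventuallyEq.refl _ _) h

theorem integral_toLp_mul {p : EuclideanSpace ℝ (Fin d) → ℝ} (hp : MemLp p 2 volume)
    (g : RealL2 d) : ∫ x, hp.toLp p x * g x = ∫ x, p x * g x := by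
  refine integral_congr_ae ?_
  filter_upwards [hp.coeFn_toLp] with x hx
  rw [hx]

theorem exists_integral_posPart_mul_le (hd : 1 ≤ d) {a q : ℝ} (ha : 0 < a) (ha1 : a ≤ 1)
    (hq : (d : ℝ) < q) :
    ∃ K : ℝ, 0 ≤ K ∧ ∀ U A : RealL2 d, IsFracLaplacian a U A → ∀ R κ : ℝ, 1 ≤ R → 0 ≤ κ →
      ∫ x, max (κ * barrier q R x - U x) 0 * A x
        ≤ K * ∫ x, max (κ * barrier q R x - U x) 0 * (κ * barrier q R x) := by
  obtain ⟨K, hK, H⟩ := exists_integral_mul_le_of_shiftForm_le hd ha ha1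
  have hq0 : 0 ≤ q := (Nat.cast_nonneg d).trans hq.le
  refine ⟨K * max 1 (q / 2), mul_nonneg hK (by positivity), fun U A hUA R κ hR hκ => ?_⟩
  have hR0 : 0 < R := by linarith
  have hW : MemLp (fun x : EuclideanSpace ℝ (Fin d) => κ * barrier q R x) 2 volume :=
    (memLp_barrier hq hR).const_mul κ
  have hp : MemLp (fun x => max (κ * barrier q R x - U x) 0) 2 volume :=
    (hW.sub (Lp.memLp U)).pos_part
  have hY : 0 ≤ ∫ x, max (κ * barrier q R x - U x) 0 * (κ * barrier q R x) :=
    integral_nonneg fun x => mul_nonneg (le_max_right _ _)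
      (mul_nonneg hκ (barrier_pos q hR0 x).le)
  have h1 := H U A (hp.toLp _) hUA
    (max 1 (q / 2) * ∫ x, max (κ * barrier q R x - U x) 0 * (κ * barrier q R x)) fun h => by
      rw [shiftForm_toLp]
      refine (shiftForm_le_of_sub_le (Lp.memLp U) hW
        (fun x => barrier_const_mul_sub_le hq0 hR0 hκ h x)).trans ?_
      linarith [mul_le_mul_of_nonneg_right (shiftRate_le (q := q) hR h) hY]
  rw [integral_toLp_mul] at h1
  linarith

theorem exists_integral_concave_mul_le (hd : 1 ≤ d) {a q : ℝ} (ha : 0 < a) (ha1 : a ≤ 1)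
    (hq : (d : ℝ) < q) :
    ∃ K : ℝ, 0 ≤ K ∧ ∀ U A : RealL2 d, IsFracLaplacian a U A → ∀ (ψ ψ' : ℝ → ℝ) (R : ℝ), 1 ≤ R →
      (∀ s t, ψ t ≤ ψ s + ψ' s * (t - s)) → MemLp (fun x => ψ (U x)) 2 volume →
      (∀ᵐ x, 0 ≤ ψ (U x)) → MemLp (fun x => ψ' (U x) * barrier q R x) 2 volume →
      ∫ x, ψ' (U x) * barrier q R x * A x ≤ K * ∫ x, ψ (U x) * barrier q R x := by
  obtain ⟨K, hK, H⟩ := exists_integral_mul_le_of_shiftForm_le hd ha ha1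
  have hq0 : 0 ≤ q := (Nat.cast_nonneg d).trans hq.le
  refine ⟨K * max 1 (q / 2), mul_nonneg hK (by positivity),
    fun U A hUA ψ ψ' R hR hψ hψU hψ0 hψ'U => ?_⟩
  have hR0 : 0 < R := by linarith
  have hY : 0 ≤ ∫ x, ψ (U x) * barrier q R x := integral_nonneg_of_ae <| by
    filter_upwards [hψ0] with x hx
    exact mul_nonneg hx (barrier_pos q hR0 x).le
  have h1 := H U A (hψ'U.toLp _) hUA (max 1 (q / 2) * ∫ x, ψ (U x) * barrier q R x) fun h => by
      rw [shiftForm_toLp]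
      refine (shiftForm_concave_le (Lp.memLp U) (memLp_barrier hq hR) hψ hψU hψ0 hψ'U
        (fun x => (barrier_pos q hR0 x).le) (fun x => barrier_sub_le hq0 hR0 h x)).trans ?_
      linarith [mul_le_mul_of_nonneg_right (shiftRate_le (q := q) hR h) hY]
  rw [integral_toLp_mul] at h1
  linarith

theorem exists_integral_concave_mul_le_scaled (hd : 1 ≤ d) {a : ℝ} (ha : 0 < a) (ha1 : a < 1) :
    ∃ K : ℝ, 0 ≤ K ∧ ∀ U A : RealL2 d, IsFracLaplacian a U A → ∀ (ψ ψ' : ℝ → ℝ) (R : ℝ), 1 ≤ R →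
      (∀ s t, ψ t ≤ ψ s + ψ' s * (t - s)) → MemLp (fun x => ψ (U x)) 2 volume →
      (∀ᵐ x, 0 ≤ ψ (U x)) → MemLp (fun x => ψ' (U x) * barrier (d + 2 * a) R x) 2 volume →
      ∫ x, ψ' (U x) * barrier (d + 2 * a) R x * A x
        ≤ K * R ^ (-(2 * a)) * ∫ x, ψ (U x) * barrier (d + 2 * a) R x := by
  obtain ⟨c, hc, H⟩ := exists_integral_mul_eq_shiftForm hd ha ha1
  have hq : (d : ℝ) < d + 2 * a := by linarith
  have hq0 : 0 ≤ (d : ℝ) + 2 * a := by positivity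
  refine ⟨c * ∫ h : EuclideanSpace ℝ (Fin d), shiftRate (d + 2 * a) 1 h * fracKernel a h,
    mul_nonneg hc.le (integral_nonneg fun h =>
      mul_nonneg (shiftRate_nonneg hq0 1 h) (fracKernel_nonneg a h)),
    fun U A hUA ψ ψ' R hR hψ hψU hψ0 hψ'U => ?_⟩
  have hR0 : 0 < R := by linarith
  obtain ⟨hi, he⟩ := H U A (hψ'U.toLp _) hUA
  rw [integral_toLp_mul] at he
  simp only [shiftForm_toLp] at hi he
  have h2 : ∫ h, shiftForm h (fun x => ψ' (U x) * barrier (d + 2 * a) R x) U * fracKernel a h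
      ≤ ∫ h : EuclideanSpace ℝ (Fin d), shiftRate (d + 2 * a) R h * fracKernel a h *
        ∫ x, ψ (U x) * barrier (d + 2 * a) R x := by
    refine integral_mono hi ((integrable_shiftRate_mul_fracKernel hd ha ha1 hq0 hR).mul_const _)
      fun h => ?_
    have := mul_le_mul_of_nonneg_right (shiftForm_concave_le (Lp.memLp U) (memLp_barrier hq hR)
      hψ hψU hψ0 hψ'U (fun x => (barrier_pos _ hR0 x).le) (fun x => barrier_sub_le hq0 hR0 h x))
      (fracKernel_nonneg a h)
    simp only
    linarith
  rw [integral_mul_const, integral_shiftRate_mul_fracKernel _ a hR0] at h2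
  rw [he]
  linarith [mul_le_mul_of_nonneg_left h2 hc.le]

theorem integrable_barrier_mul_shift {q R : ℝ} (hq : (d : ℝ) < q) (hR : 1 ≤ R)
    {p w : EuclideanSpace ℝ (Fin d) → ℝ} (hp : MemLp p 2 volume) (hw : MemLp w 2 volume)
    (hpm : StronglyMeasurable p) (hwm : StronglyMeasurable w) :
    Integrable (fun z : EuclideanSpace ℝ (Fin d) × EuclideanSpace ℝ (Fin d) =>
      barrier q R z.1 * (p z.2 * w (z.2 + z.1))) (volume.prod volume) := by
  have hR0 : 0 < R := by linarith
  have hm : StronglyMeasurable (fun z : EuclideanSpace ℝ (Fin d) × EuclideanSpace ℝ (Fin d) =>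
      barrier q R z.1 * (p z.2 * w (z.2 + z.1))) :=
    ((continuous_barrier q hR0).comp continuous_fst).stronglyMeasurable.mul
      ((hpm.comp_measurable measurable_snd).mul
        (hwm.comp_measurable (measurable_snd.add measurable_fst)))
  refine (integrable_prod_iff hm.aestronglyMeasurable).2 ⟨ae_of_all _ fun h =>
    (integrable_mul_shift h hp hw).const_mul (barrier q R h), ?_⟩
  set M : ℝ := ∫ x, (p x ^ 2 + w x ^ 2) with hM
  refine ((integrable_barrier hq hR).mul_const M).mono'
    hm.norm.integral_prod_right.aestronglyMeasurable (ae_of_all _ fun h => ?_)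
  have hb := (barrier_pos q hR0 h).le
  rw [Real.norm_of_nonneg (integral_nonneg fun _ => norm_nonneg _)]
  simp only [norm_mul (barrier q R h), Real.norm_of_nonneg hb]
  rw [integral_const_mul]
  refine mul_le_mul_of_nonneg_left ?_ hb
  have hwh : Integrable (fun x => w (x + h) ^ 2) volume := hw.integrable_sq.comp_add_right h
  have e : ∫ x, w (x + h) ^ 2 = ∫ x, w x ^ 2 := integral_add_right_eq_self (fun x => w x ^ 2) h
  rw [hM, integral_add hp.integrable_sq hw.integrable_sq, ← e, ← integral_add hp.integrable_sq hwh]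
  refine integral_mono (integrable_mul_shift h hp hw).norm (hp.integrable_sq.add hwh) fun x => ?_
  simp only [Real.norm_eq_abs, abs_mul]
  nlinarith [sq_nonneg (|p x| - |w (x + h)|), sq_abs (p x), sq_abs (w (x + h)), sq_nonneg (p x),
    sq_nonneg (w (x + h))]

/-- The gain from jumps: after Fubini the inner integral is `p x` times the mass of `w` seen through
`b_R(z - x)`, bounded below by `barrier_mul_le`. -/
theorem integral_barrier_mul_shift_ge {q R : ℝ} (hq : (d : ℝ) < q) (hR : 1 ≤ R)
    {p w : EuclideanSpace ℝ (Fin d) → ℝ} (hp : MemLp p 2 volume) (hw : MemLp w 2 volume)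
    (hpm : StronglyMeasurable p) (hwm : StronglyMeasurable w) (hp0 : ∀ x, 0 ≤ p x)
    (hw0 : ∀ᵐ x, 0 ≤ w x) :
    2 ^ (-q / 2) * R ^ q * (∫ x, p x * barrier q R x) * (∫ x, w x * barrier q R x)
      ≤ ∫ h, barrier q R h * ∫ x, p x * w (x + h) := by
  have hR0 : 0 < R := by linarith
  have hq0 : 0 ≤ q := (Nat.cast_nonneg d).trans hq.le
  have hG := integrable_barrier_mul_shift hq hR hp hw hpm hwm
  have h1 : ∫ h, barrier q R h * ∫ x, p x * w (x + h)
      = ∫ x, ∫ h, barrier q R h * (p x * w (x + h)) := by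
    rw [← integral_integral_swap hG]
    simp only [integral_const_mul]
  have hbw : Integrable (fun x => w x * barrier q R x) volume :=
    hw.integrable_mul (memLp_barrier hq hR)
  have hpb : Integrable (fun x => p x * barrier q R x) volume :=
    hp.integrable_mul (memLp_barrier hq hR)
  have h2 : ∀ x, p x * barrier q R x * (2 ^ (-q / 2) * R ^ q * ∫ z, w z * barrier q R z)
      ≤ ∫ h, barrier q R h * (p x * w (x + h)) := by
    intro x
    have e1 : ∫ h, barrier q R h * (p x * w (x + h)) = p x * ∫ z, w z * barrier q R (z - x) := by
      rw [← integral_const_mul,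
        ← integral_add_left_eq_self (fun z => p x * (w z * barrier q R (z - x))) x]
      congr 1
      ext h
      rw [add_sub_cancel_left]
      ring
    have e2 : (2 ^ (-q / 2) * R ^ q * barrier q R x) * ∫ z, w z * barrier q R z
        ≤ ∫ z, w z * barrier q R (z - x) := by
      rw [← integral_const_mul]
      refine integral_mono_ae (hbw.const_mul _)
        (integrable_mul_shift_sub hw (memLp_barrier hq hR) x) ?_
      filter_upwards [hw0] with z hz
      linarith [mul_le_mul_of_nonneg_left (barrier_mul_le hq0 hR0 x z) hz]
    rw [e1]
    linarith [mul_le_mul_of_nonneg_left e2 (hp0 x)]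
  rw [h1]
  calc _ = ∫ x, p x * barrier q R x * (2 ^ (-q / 2) * R ^ q * ∫ z, w z * barrier q R z) := by
        rw [integral_mul_const]
        ring
    _ ≤ _ := integral_mono (hpb.mul_const _) hG.integral_prod_right h2

/-- The jump kernel is split as `(kernel - b_R) + b_R`, both parts nonnegative. On the first part
the difference is bounded by the barrier rate; on the second the shifted values of `U` are kept, and
they produce the negative term. -/
theorem exists_integral_posPart_mul_le_scaled (hd : 1 ≤ d) {a : ℝ} (ha : 0 < a) (ha1 : a < 1) :
    ∃ K k : ℝ, 0 ≤ K ∧ 0 < k ∧ ∀ U A : RealL2 d, IsFracLaplacian a U A → (∀ᵐ x, 0 ≤ U x) →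
      ∀ R κ : ℝ, 1 ≤ R → 0 ≤ κ →
      ∫ x, max (κ * barrier (d + 2 * a) R x - U x) 0 * A x
        ≤ K * R ^ (-(2 * a)) *
            (∫ x, max (κ * barrier (d + 2 * a) R x - U x) 0 * (κ * barrier (d + 2 * a) R x))
          - k * R ^ ((d : ℝ) + 2 * a) *
            (∫ x, max (κ * barrier (d + 2 * a) R x - U x) 0 * barrier (d + 2 * a) R x) *
            ∫ x, U x * barrier (d + 2 * a) R x := by
  obtain ⟨c, hc, H⟩ := exists_integral_mul_eq_shiftForm hd ha ha1
  set q : ℝ := (d : ℝ) + 2 * a with hqd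
  have hq : (d : ℝ) < q := by linarith
  have hq0 : 0 ≤ q := by positivity
  set I1 : ℝ := ∫ h : EuclideanSpace ℝ (Fin d), shiftRate q 1 h * fracKernel a h with hI1
  set I2 : ℝ := ∫ h : EuclideanSpace ℝ (Fin d), barrier q 1 h with hI2
  have hI1n : 0 ≤ I1 := integral_nonneg fun h =>
    mul_nonneg (shiftRate_nonneg hq0 1 h) (fracKernel_nonneg a h)
  have hI2n : 0 ≤ I2 := integral_nonneg fun h => (barrier_pos q one_pos h).le
  refine ⟨c * (I1 + I2), c * 2 ^ (-q / 2), by positivity, by positivity,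
    fun U A hUA hU0 R κ hR hκ => ?_⟩
  have hR0 : 0 < R := by linarith
  set p : EuclideanSpace ℝ (Fin d) → ℝ := fun x => max (κ * barrier q R x - U x) 0 with hpdef
  have hW : MemLp (fun x : EuclideanSpace ℝ (Fin d) => κ * barrier q R x) 2 volume :=
    (memLp_barrier hq hR).const_mul κ
  have hp : MemLp p 2 volume := (hW.sub (Lp.memLp U)).pos_part
  have hpm : StronglyMeasurable p :=
    (((continuous_barrier q hR0).stronglyMeasurable.const_mul κ).sub
      (Lp.stronglyMeasurable U)).sup stronglyMeasurable_const
  have hp0 : ∀ x, 0 ≤ p x := fun x => le_max_right _ _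
  obtain ⟨hi, he⟩ := H U A (hp.toLp _) hUA
  rw [integral_toLp_mul] at he
  simp only [shiftForm_toLp] at hi he
  set Y : ℝ := ∫ x, p x * (κ * barrier q R x) with hY
  set J : EuclideanSpace ℝ (Fin d) → ℝ := fun h => ∫ x, p x * U (x + h) with hJ
  have hbJ : Integrable (fun h => barrier q R h * J h) volume := by
    have := (integrable_barrier_mul_shift hq hR hp (Lp.memLp U) hpm
      (Lp.stronglyMeasurable U)).integral_prod_left
    simpa only [integral_const_mul] using this
  have hbJ' : Integrable (fun h => barrier q R h * J (-h)) volume := by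
    have := hbJ.comp_neg
    simpa only [barrier_neg] using this
  have hbJe : ∫ h, barrier q R h * J (-h) = ∫ h, barrier q R h * J h := by
    rw [← integral_neg_eq_self]
    simp only [barrier_neg, neg_neg]
  -- Where `p` is nonzero, `U` lies below `κ b_R`.
  have hpU : ∫ x, p x * U x ≤ Y := by
    refine integral_mono (hp.integrable_mul (Lp.memLp U)) (hp.integrable_mul hW) fun x => ?_
    simp only [hpdef]
    rcases le_total (κ * barrier q R x - U x) 0 with h0 | h0
    · simp [h0]
    · exact mul_le_mul_of_nonneg_left (by linarith) (le_max_right _ _)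
  have hb1 : ∀ h, shiftForm h p U ≤ shiftRate q R h * Y := fun h =>
    shiftForm_le_of_sub_le (Lp.memLp U) hW (fun x => barrier_const_mul_sub_le hq0 hR0 hκ h x)
  have hb2 : ∀ h, shiftForm h p U ≤ Y - (J h + J (-h)) / 2 := fun h => by
    rw [shiftForm_eq hp (Lp.memLp U)]
    simp only [hJ, sub_eq_add_neg]
    simp only [← sub_eq_add_neg]
    linarith
  have hYn : 0 ≤ Y := integral_nonneg fun x =>
    mul_nonneg (hp0 x) (mul_nonneg hκ (barrier_pos q hR0 x).le)
  have hne : ∀ᵐ h : EuclideanSpace ℝ (Fin d), h ≠ 0 := by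
    have : Nonempty (Fin d) := ⟨⟨0, by omega⟩⟩
    exact Measure.ae_ne volume 0
  have i1 : Integrable (fun h : EuclideanSpace ℝ (Fin d) => shiftRate q R h * fracKernel a h * Y)
      volume := (integrable_shiftRate_mul_fracKernel hd ha ha1 hq0 hR).mul_const Y
  have i2 : Integrable (fun h : EuclideanSpace ℝ (Fin d) => barrier q R h * Y) volume :=
    (integrable_barrier hq hR).mul_const Y
  have i12 : Integrable (fun h : EuclideanSpace ℝ (Fin d) =>
      shiftRate q R h * fracKernel a h * Y + barrier q R h * Y) volume := i1.add i2
  have i3 : Integrable (fun h : EuclideanSpace ℝ (Fin d) =>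
      (barrier q R h * J h + barrier q R h * J (-h)) / 2) volume := (hbJ.add hbJ').div_const 2
  have hmain : ∫ h, shiftForm h p U * fracKernel a h
      ≤ ∫ h, (shiftRate q R h * fracKernel a h * Y + barrier q R h * Y
        - (barrier q R h * J h + barrier q R h * J (-h)) / 2) := by
    refine integral_mono_ae hi (i12.sub i3) ?_
    filter_upwards [hne] with h hh
    have h1 := barrier_le_fracKernel (R := R) hd ha hh
    -- `hb1` is weighted by `kernel - b_R` and `hb2` by `b_R`.
    have h2 := mul_le_mul_of_nonneg_left (hb1 h) (sub_nonneg.2 h1)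
    have h3 := mul_le_mul_of_nonneg_left (hb2 h) (barrier_pos q hR0 h).le
    have h4 : 0 ≤ barrier q R h * (shiftRate q R h * Y) :=
      mul_nonneg (barrier_pos q hR0 h).le (mul_nonneg (shiftRate_nonneg hq0 R h) hYn)
    linarith
  rw [integral_sub i12 i3, integral_add i1 i2, integral_mul_const, integral_mul_const,
    integral_div, integral_add hbJ hbJ', hbJe, integral_shiftRate_mul_fracKernel q a hR0] at hmain
  rw [hqd, integral_barrier a hR0, ← hqd, ← hI1, ← hI2] at hmain
  have hJge := integral_barrier_mul_shift_ge hq hR hp (Lp.memLp U) hpm (Lp.stronglyMeasurable U)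
    hp0 hU0
  rw [he]
  have := mul_le_mul_of_nonneg_left hmain hc.le
  have := mul_le_mul_of_nonneg_left hJge hc.le
  linarith

end Operator

/-! ### Differentiation with quadratic remainder, Gronwall, and the truncation. -/

section Calculus

/-- The remainder is `O(‖U s - U t‖²) = o(s - t)`. Thus pointwise quadratic bounds on an integrand
differentiate the energies. -/
theorem hasDerivAt_of_sub_inner_le {H : Type*} [NormedAddCommGroup H] [InnerProductSpace ℝ H]
    {U : ℝ → H} {V G : H} {F : ℝ → ℝ} {C t : ℝ} (hU : HasDerivAt U V t)
    (hF : ∀ᶠ s in nhds t, |F s - F t - inner ℝ G (U s - U t)| ≤ C * ‖U s - U t‖ ^ 2) :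
    HasDerivAt F (inner ℝ G V) t := by
  have h1 : HasDerivAt (fun s => inner ℝ G (U s)) (inner ℝ G V) t :=
    (innerSL ℝ G).hasFDerivAt.comp_hasDerivAt t hU
  have h2 : (fun s => ‖U s - U t‖ ^ 2) =o[nhds t] fun s => s - t := by
    have hO : (fun s => ‖U s - U t‖) =O[nhds t] fun s => s - t := hU.isBigO_sub.norm_left
    have ho : (fun s => ‖U s - U t‖) =o[nhds t] fun _ => (1 : ℝ) := by
      rw [Asymptotics.isLittleO_one_iff]
      have h := (hU.continuousAt.sub (continuousAt_const (y := U t))).norm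
      simpa [ContinuousAt] using h
    have := hO.mul_isLittleO ho
    simpa [sq] using this
  have h3 : (fun s => F s - F t - inner ℝ G (U s - U t)) =o[nhds t] fun s => s - t := by
    refine Asymptotics.IsBigO.trans_isLittleO (Asymptotics.IsBigO.of_bound C ?_) h2
    filter_upwards [hF] with s hs
    rwa [Real.norm_eq_abs, Real.norm_of_nonneg (by positivity)]
  rw [hasDerivAt_iff_isLittleO] at h1 ⊢
  refine (h1.add h3).congr_left fun s => ?_
  rw [inner_sub_right]
  simp only [smul_eq_mul]
  ring

theorem exp_mul_le_of_neg_mul_le_deriv {N N' : ℝ → ℝ} {C t₀ t₁ : ℝ} (h01 : t₀ ≤ t₁)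
    (hc : ContinuousOn N (Icc t₀ t₁)) (hd : ∀ s ∈ Ioo t₀ t₁, HasDerivAt N (N' s) s)
    (hN : ∀ s ∈ Ioo t₀ t₁, -C * N s ≤ N' s) :
    Real.exp (-C * (t₁ - t₀)) * N t₀ ≤ N t₁ := by
  have hexp : ∀ s : ℝ, HasDerivAt (fun s => Real.exp (C * s)) (Real.exp (C * s) * C) s := fun s => by
    simpa using ((hasDerivAt_id s).const_mul C).exp
  have hmono : MonotoneOn (fun s => Real.exp (C * s) * N s) (Icc t₀ t₁) := by
    refine monotoneOn_of_deriv_nonneg (convex_Icc _ _)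
      (ContinuousOn.mul (Continuous.continuousOn (by fun_prop)) hc) ?_ ?_
    · rw [interior_Icc]
      exact fun s hs => ((hexp s).mul (hd s hs)).differentiableAt.differentiableWithinAt
    · rw [interior_Icc]
      intro s hs
      refine le_of_le_of_eq ?_ ((hexp s).mul (hd s hs)).deriv.symm
      nlinarith [mul_le_mul_of_nonneg_left (hN s hs) (Real.exp_pos (C * s)).le]
  have h := hmono (left_mem_Icc.2 h01) (right_mem_Icc.2 h01) h01
  have h2 := mul_le_mul_of_nonneg_left h (Real.exp_pos (-(C * t₁))).le
  simp only [← mul_assoc, ← Real.exp_add] at h2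
  rw [neg_add_cancel, Real.exp_zero, one_mul] at h2
  rwa [show -C * (t₁ - t₀) = -(C * t₁) + C * t₀ by ring]

theorem posPart_sq_sub_mem (a b : ℝ) :
    0 ≤ max b 0 ^ 2 - max a 0 ^ 2 - 2 * max a 0 * (b - a) ∧
      max b 0 ^ 2 - max a 0 ^ 2 - 2 * max a 0 * (b - a) ≤ (b - a) ^ 2 := by
  rcases le_total a 0 with ha | ha <;> rcases le_total b 0 with hb | hb <;>
    simp only [ha, hb, max_eq_left, max_eq_right] <;> constructor <;>
    nlinarith [sq_nonneg (b - a)]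

/-- A concave `C^{1,1}` truncation of the identity, constant on `[Λ, ∞)`. -/
def trunc (Λ s : ℝ) : ℝ :=
  Λ / 2 - max (Λ - s) 0 ^ 2 / (2 * Λ)

/-- The derivative of `trunc Λ`. -/
def truncDeriv (Λ s : ℝ) : ℝ :=
  max (Λ - s) 0 / Λ

theorem continuous_trunc (Λ : ℝ) : Continuous (trunc Λ) := by
  unfold trunc
  fun_prop

theorem continuous_truncDeriv (Λ : ℝ) : Continuous (truncDeriv Λ) := by
  unfold truncDeriv
  fun_prop

/-- Concavity in tangent form, valid at all real points as `shiftForm_concave_le` requires. -/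
theorem trunc_le_add {Λ : ℝ} (hΛ : 0 < Λ) (s t : ℝ) :
    trunc Λ t ≤ trunc Λ s + truncDeriv Λ s * (t - s) := by
  have h := (posPart_sq_sub_mem (Λ - s) (Λ - t)).1
  have e : trunc Λ s + truncDeriv Λ s * (t - s) - trunc Λ t
      = (max (Λ - t) 0 ^ 2 - max (Λ - s) 0 ^ 2 - 2 * max (Λ - s) 0 * (Λ - t - (Λ - s))) / (2 * Λ) := by
    unfold trunc truncDeriv
    field_simp
    ring
  have : 0 ≤ trunc Λ s + truncDeriv Λ s * (t - s) - trunc Λ t := by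
    rw [e]
    positivity
  linarith

theorem abs_trunc_sub_le {Λ : ℝ} (hΛ : 0 < Λ) (s t : ℝ) :
    |trunc Λ t - trunc Λ s - truncDeriv Λ s * (t - s)| ≤ (t - s) ^ 2 / (2 * Λ) := by
  obtain ⟨h1, h2⟩ := posPart_sq_sub_mem (Λ - s) (Λ - t)
  have e : trunc Λ t - trunc Λ s - truncDeriv Λ s * (t - s)
      = -((max (Λ - t) 0 ^ 2 - max (Λ - s) 0 ^ 2 - 2 * max (Λ - s) 0 * (Λ - t - (Λ - s))) / (2 * Λ)) := by
    unfold trunc truncDeriv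
    field_simp
    ring
  rw [e, abs_neg, abs_of_nonneg (by positivity)]
  gcongr
  linarith [h2, show (Λ - t - (Λ - s)) ^ 2 = (t - s) ^ 2 by ring]

theorem truncDeriv_nonneg {Λ : ℝ} (hΛ : 0 < Λ) (s : ℝ) : 0 ≤ truncDeriv Λ s :=
  div_nonneg (le_max_right _ _) hΛ.le

theorem truncDeriv_le_one {Λ s : ℝ} (hΛ : 0 < Λ) (hs : 0 ≤ s) : truncDeriv Λ s ≤ 1 := by
  rw [truncDeriv, div_le_one hΛ]
  exact max_le (by linarith) hΛ.le

theorem truncDeriv_eq_zero {Λ s : ℝ} (hs : Λ ≤ s) : truncDeriv Λ s = 0 := by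
  rw [truncDeriv, max_eq_right (by linarith), zero_div]

theorem trunc_zero {Λ : ℝ} (hΛ : 0 < Λ) : trunc Λ 0 = 0 := by
  rw [trunc, sub_zero, max_eq_left hΛ.le]
  field_simp
  ring

theorem truncDeriv_zero {Λ : ℝ} (hΛ : 0 < Λ) : truncDeriv Λ 0 = 1 := by
  rw [truncDeriv, sub_zero, max_eq_left hΛ.le, div_self hΛ.ne']

theorem truncDeriv_mul_le {Λ s : ℝ} (hΛ : 0 < Λ) (hs : 0 ≤ s) : truncDeriv Λ s * s ≤ trunc Λ s := by
  have h := trunc_le_add hΛ s 0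
  rw [trunc_zero hΛ] at h
  linarith

theorem trunc_nonneg {Λ s : ℝ} (hΛ : 0 < Λ) (hs : 0 ≤ s) : 0 ≤ trunc Λ s :=
  (mul_nonneg (truncDeriv_nonneg hΛ s) hs).trans (truncDeriv_mul_le hΛ hs)

theorem trunc_le_self {Λ : ℝ} (hΛ : 0 < Λ) (s : ℝ) : trunc Λ s ≤ s := by
  have h := trunc_le_add hΛ 0 s
  rw [trunc_zero hΛ, truncDeriv_zero hΛ] at h
  linarith

theorem trunc_pos {Λ s : ℝ} (hΛ : 0 < Λ) (hs : 0 < s) : 0 < trunc Λ s := by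
  have h : max (Λ - s) 0 ^ 2 < Λ ^ 2 := by
    refine pow_lt_pow_left₀ (max_lt (by linarith) hΛ) (le_max_right _ _) two_ne_zero
  rw [trunc, sub_pos, div_lt_div_iff₀ (by positivity) (by positivity)]
  nlinarith

end Calculus

/-! ### Time derivatives of the energy and of the truncated mass. -/

section EnergyDerivatives

variable {d : ℕ}

theorem real_inner_eq_integral (p w : RealL2 d) : inner ℝ p w = ∫ x, p x * w x := by
  rw [L2.inner_def]
  congr 1
  ext x
  simp [mul_comm]

theorem norm_sq_eq_integral (w : RealL2 d) : ‖w‖ ^ 2 = ∫ x, w x ^ 2 := by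
  rw [← real_inner_self_eq_norm_sq, real_inner_eq_integral]
  simp only [sq]

theorem integral_sub_sq (v w : RealL2 d) : ∫ x, (v x - w x) ^ 2 = ‖v - w‖ ^ 2 := by
  rw [norm_sq_eq_integral]
  refine integral_congr_ae ?_
  filter_upwards [Lp.coeFn_sub v w] with x hx
  rw [hx, Pi.sub_apply]

theorem hasDerivAt_integral_posPart_sq {v : ℝ → RealL2 d} {v' : RealL2 d} {t : ℝ}
    (hv : HasDerivAt v v' t) :
    HasDerivAt (fun s => ∫ x, max (v s x) 0 ^ 2 / 2) (∫ x, max (v t x) 0 * v' x) t := by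
  have hp : ∀ s, MemLp (fun x => max (v s x) 0) 2 volume := fun s => (Lp.memLp (v s)).pos_part
  have e : ∫ x, max (v t x) 0 * v' x = inner ℝ ((hp t).toLp _) v' := by
    rw [real_inner_eq_integral, integral_toLp_mul]
  rw [e]
  refine hasDerivAt_of_sub_inner_le (C := 1 / 2) hv (Eventually.of_forall fun s => ?_)
  have i1 : ∀ s, Integrable (fun x => max (v s x) 0 ^ 2 / 2) volume :=
    fun s => (hp s).integrable_sq.div_const 2
  have i2 : Integrable (fun x => max (v t x) 0 * (v s x - v t x)) volume :=
    (hp t).integrable_mul ((Lp.memLp (v s)).sub (Lp.memLp (v t)))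
  have e2 : inner ℝ ((hp t).toLp _) (v s - v t) = ∫ x, max (v t x) 0 * (v s x - v t x) := by
    rw [real_inner_eq_integral, integral_toLp_mul]
    refine integral_congr_ae ?_
    filter_upwards [Lp.coeFn_sub (v s) (v t)] with x hx
    rw [hx, Pi.sub_apply]
  have i3 : Integrable (fun x => max (v s x) 0 ^ 2 / 2 - max (v t x) 0 ^ 2 / 2) volume :=
    (i1 s).sub (i1 t)
  rw [e2, ← integral_sub (i1 s) (i1 t), ← integral_sub i3 i2, ← integral_sub_sq,
    ← integral_const_mul]
  refine (abs_integral_le_integral_abs).trans (integral_mono (i3.sub i2).abs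
    ((((Lp.memLp (v s)).sub (Lp.memLp (v t))).integrable_sq).const_mul _) fun x => ?_)
  obtain ⟨h1, h2⟩ := posPart_sq_sub_mem (v t x) (v s x)
  simp only
  rw [abs_le]
  constructor <;> nlinarith

theorem continuous_integral_posPart_sq :
    Continuous fun v : RealL2 d => ∫ x, max (v x) 0 ^ 2 / 2 := by
  have h : (fun v : RealL2 d => ∫ x, max (v x) 0 ^ 2 / 2) = fun v => ‖Lp.posPart v‖ ^ 2 / 2 := by
    funext v
    rw [norm_sq_eq_integral, integral_div]
    congr 1
    refine integral_congr_ae ?_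
    filter_upwards [Lp.coeFn_posPart v] with x hx
    rw [hx]
  rw [h]
  have := Lp.continuous_posPart (α := EuclideanSpace ℝ (Fin d)) (μ := volume) (p := 2)
  fun_prop

theorem memLp_trunc {Λ : ℝ} (hΛ : 0 < Λ) {U : RealL2 d} (hU : ∀ᵐ x, 0 ≤ U x) :
    MemLp (fun x => trunc Λ (U x)) 2 volume := by
  refine (Lp.memLp U).of_le ((continuous_trunc Λ).comp_aestronglyMeasurable
    (Lp.aestronglyMeasurable U)) ?_
  filter_upwards [hU] with x hx
  rw [Real.norm_of_nonneg (trunc_nonneg hΛ hx), Real.norm_of_nonneg hx]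
  exact trunc_le_self hΛ _

theorem memLp_truncDeriv_mul {Λ q R : ℝ} (hΛ : 0 < Λ) (hq : (d : ℝ) < q) (hR : 1 ≤ R)
    {U : RealL2 d} (hU : ∀ᵐ x, 0 ≤ U x) :
    MemLp (fun x => truncDeriv Λ (U x) * barrier q R x) 2 volume := by
  refine (memLp_barrier hq hR).of_le (((continuous_truncDeriv Λ).comp_aestronglyMeasurable
    (Lp.aestronglyMeasurable U)).mul
    (continuous_barrier q (by linarith)).aestronglyMeasurable) ?_
  filter_upwards [hU] with x hx
  rw [norm_mul, Real.norm_of_nonneg (truncDeriv_nonneg hΛ _)]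
  exact mul_le_of_le_one_left (norm_nonneg _) (truncDeriv_le_one hΛ hx)

theorem hasDerivAt_integral_trunc {Λ q R : ℝ} (hΛ : 0 < Λ) (hq : (d : ℝ) < q) (hR : 1 ≤ R)
    {U : ℝ → RealL2 d} {V : RealL2 d} {t : ℝ} (hU : HasDerivAt U V t)
    (h0 : ∀ᶠ s in nhds t, ∀ᵐ x, 0 ≤ U s x) :
    HasDerivAt (fun s => ∫ x, trunc Λ (U s x) * barrier q R x)
      (∫ x, truncDeriv Λ (U t x) * barrier q R x * V x) t := by
  have hq0 : 0 ≤ q := (Nat.cast_nonneg d).trans hq.le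
  have hp := memLp_truncDeriv_mul hΛ hq hR h0.self_of_nhds
  have e : ∫ x, truncDeriv Λ (U t x) * barrier q R x * V x = inner ℝ (hp.toLp _) V := by
    rw [real_inner_eq_integral, integral_toLp_mul]
  rw [e]
  refine hasDerivAt_of_sub_inner_le (C := 1 / (2 * Λ)) hU ?_
  filter_upwards [h0] with s hs
  have e2 : inner ℝ (hp.toLp _) (U s - U t)
      = ∫ x, truncDeriv Λ (U t x) * barrier q R x * (U s x - U t x) := by
    rw [real_inner_eq_integral, integral_toLp_mul]
    refine integral_congr_ae ?_
    filter_upwards [Lp.coeFn_sub (U s) (U t)] with x hx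
    rw [hx, Pi.sub_apply]
  have i1 : Integrable (fun x => trunc Λ (U s x) * barrier q R x) volume :=
    (memLp_trunc hΛ hs).integrable_mul (memLp_barrier hq hR)
  have i1' : Integrable (fun x => trunc Λ (U t x) * barrier q R x) volume :=
    (memLp_trunc hΛ h0.self_of_nhds).integrable_mul (memLp_barrier hq hR)
  have i2 : Integrable (fun x => truncDeriv Λ (U t x) * barrier q R x * (U s x - U t x)) volume :=
    hp.integrable_mul ((Lp.memLp (U s)).sub (Lp.memLp (U t)))
  have i3 : Integrable (fun x => trunc Λ (U s x) * barrier q R x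
      - trunc Λ (U t x) * barrier q R x) volume := i1.sub i1'
  rw [e2, ← integral_sub i1 i1', ← integral_sub i3 i2, ← integral_sub_sq, ← integral_const_mul]
  refine (abs_integral_le_integral_abs).trans (integral_mono (i3.sub i2).abs
    ((((Lp.memLp (U s)).sub (Lp.memLp (U t))).integrable_sq).const_mul _) fun x => ?_)
  have h1 := abs_trunc_sub_le hΛ (U t x) (U s x)
  have hb := (barrier_pos q (R := R) (by linarith) x).le
  have hb1 := barrier_le_one hq0 hR x
  simp only
  calc |trunc Λ (U s x) * barrier q R x - trunc Λ (U t x) * barrier q R x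
        - truncDeriv Λ (U t x) * barrier q R x * (U s x - U t x)|
      = |trunc Λ (U s x) - trunc Λ (U t x) - truncDeriv Λ (U t x) * (U s x - U t x)|
          * barrier q R x := by
        rw [← abs_of_nonneg hb, ← abs_mul, abs_of_nonneg hb]
        congr 1
        ring
    _ ≤ |trunc Λ (U s x) - trunc Λ (U t x) - truncDeriv Λ (U t x) * (U s x - U t x)| :=
        mul_le_of_le_one_right (abs_nonneg _) hb1
    _ ≤ _ := h1.trans_eq (by ring)

theorem continuousOn_integral_trunc {Λ q R : ℝ} (hΛ : 0 < Λ) (hq : (d : ℝ) < q) (hR : 1 ≤ R)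
    {U : ℝ → RealL2 d} {S : Set ℝ} (hU : ContinuousOn U S) (h0 : ∀ s ∈ S, ∀ᵐ x, 0 ≤ U s x) :
    ContinuousOn (fun s => ∫ x, trunc Λ (U s x) * barrier q R x) S := by
  have hb := memLp_barrier (d := d) hq hR
  -- `trunc Λ` is quadratic at `-∞`, hence not Lipschitz. Composing with `max · 0` repairs this and
  -- changes nothing on nonnegative functions.
  have hlip : LipschitzWith (Real.toNNReal 2) fun s => trunc Λ (max s 0) := by
    refine LipschitzWith.of_dist_le_mul fun s t => ?_
    rw [Real.coe_toNNReal _ zero_le_two, Real.dist_eq, Real.dist_eq, abs_le]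
    have hst : |max s 0 - max t 0| ≤ |s - t| := abs_max_sub_max_le_abs s t 0
    have bound : ∀ a b : ℝ, |max a 0 - max b 0| ≤ |s - t| →
        trunc Λ (max a 0) - trunc Λ (max b 0) ≤ |s - t| := by
      intro a b hab
      have h1 := trunc_le_add hΛ (max b 0) (max a 0)
      have h2 := truncDeriv_nonneg hΛ (max b 0)
      have h3 := truncDeriv_le_one hΛ (le_max_right b 0)
      have h4 : truncDeriv Λ (max b 0) * (max a 0 - max b 0) ≤ 1 * |s - t| :=
        (mul_le_mul_of_nonneg_left ((le_abs_self _).trans hab) h2).trans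
          (mul_le_mul_of_nonneg_right h3 (abs_nonneg _))
      linarith
    have b1 := bound s t hst
    have b2 := bound t s (by rwa [abs_sub_comm])
    constructor <;> linarith [abs_nonneg (s - t)]
  have h00 : trunc Λ (max 0 0) = 0 := by rw [max_self, trunc_zero hΛ]
  have hcont : Continuous fun w : RealL2 d => inner ℝ (hb.toLp _) (hlip.compLp h00 w) :=
    continuous_const.inner (hlip.continuous_compLp h00)
  refine (hcont.comp_continuousOn hU).congr fun s hs => ?_
  simp only [Function.comp_apply]
  rw [real_inner_eq_integral, integral_toLp_mul]
  refine integral_congr_ae ?_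
  filter_upwards [hlip.coeFn_compLp h00 (U s), h0 s hs] with x h1 h2
  rw [h1, Function.comp_apply, max_eq_left h2, mul_comm]

end EnergyDerivatives

/-! ### Monotonicity and one-dimensional bounds for the reaction. -/

section Reaction

variable {m : ℕ}

theorem fderiv_apply_eq_sum_partialD (g : (Fin m → ℝ) → ℝ) (s v : Fin m → ℝ) :
    fderiv ℝ g s v = ∑ j, v j * partialD j g s := by
  conv_lhs => rw [← Finset.univ_sum_single v, map_sum]
  refine Finset.sum_congr rfl fun j _ => ?_
  rw [partialD, ← smul_eq_mul, ← map_smul, ← Pi.single_smul, smul_eq_mul, mul_one]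

/-- Along the segment from `s` to `s'` the direction has no `i`-component, so the sign of the `i`-th
derivative does not matter. -/
theorem le_of_le_of_partialD_nonneg {g : (Fin m → ℝ) → ℝ} (hg : ContDiff ℝ 1 g) {i : Fin m}
    (hcoop : ∀ j, j ≠ i → ∀ s, 0 ≤ partialD j g s) {s s' : Fin m → ℝ} (hs : s ≤ s')
    (hi : s i = s' i) : g s ≤ g s' := by
  have hd : ∀ τ : ℝ, HasDerivAt (fun τ : ℝ => g (s + τ • (s' - s)))
      (fderiv ℝ g (s + τ • (s' - s)) (s' - s)) τ := by
    intro τ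
    have h1 : HasDerivAt (fun τ : ℝ => s + τ • (s' - s)) (s' - s) τ := by
      simpa using ((hasDerivAt_id τ).smul_const (s' - s)).const_add s
    exact ((hg.differentiable one_ne_zero).differentiableAt.hasFDerivAt).comp_hasDerivAt τ h1
  have hmono : Monotone fun τ : ℝ => g (s + τ • (s' - s)) := by
    refine monotone_of_deriv_nonneg (fun τ => (hd τ).differentiableAt) fun τ => ?_
    rw [(hd τ).deriv, fderiv_apply_eq_sum_partialD]
    refine Finset.sum_nonneg fun j _ => ?_
    rcases eq_or_ne j i with rfl | hj
    · simp [hi]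
    · exact mul_nonneg (sub_nonneg.2 (hs j)) (hcoop j hj _)
  have := hmono zero_le_one
  simpa using this

theorem hasDerivAt_comp_single {g : (Fin m → ℝ) → ℝ} (hg : ContDiff ℝ 1 g) (j : Fin m) (s : ℝ) :
    HasDerivAt (fun s : ℝ => g (Pi.single j s)) (partialD j g (Pi.single j s)) s := by
  have h1 : HasDerivAt (fun s : ℝ => (Pi.single j s : Fin m → ℝ)) (Pi.single j 1) s :=
    hasDerivAt_single j s
  exact ((hg.differentiable one_ne_zero).differentiableAt.hasFDerivAt).comp_hasDerivAt s h1

theorem mul_le_of_le_partialD {g : (Fin m → ℝ) → ℝ} (hg : ContDiff ℝ 1 g) (h0 : g 0 = 0)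
    {j : Fin m} {c Λ : ℝ} (hc : ∀ s ∈ Icc 0 Λ, c ≤ partialD j g (Pi.single j s)) {s : ℝ}
    (hs : s ∈ Icc 0 Λ) : c * s ≤ g (Pi.single j s) := by
  have hd : ∀ s, HasDerivAt (fun s : ℝ => g (Pi.single j s) - c * s)
      (partialD j g (Pi.single j s) - c) s := fun s => by
    have h := (hasDerivAt_comp_single hg j s).sub ((hasDerivAt_id s).const_mul c)
    rw [mul_one] at h
    exact h
  have hmono : MonotoneOn (fun s : ℝ => g (Pi.single j s) - c * s) (Icc 0 Λ) := by
    refine monotoneOn_of_deriv_nonneg (convex_Icc _ _)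
      (fun s _ => (hd s).continuousAt.continuousWithinAt)
      (fun s _ => (hd s).differentiableAt.differentiableWithinAt) fun s hs => ?_
    rw [(hd s).deriv]
    linarith [hc s (interior_subset hs)]
  have h := hmono ⟨le_rfl, hs.1.trans hs.2⟩ hs hs.1
  simp only [Pi.single_zero, h0] at h
  linarith

theorem exists_pos_mul_le_comp_single {g : (Fin m → ℝ) → ℝ} (hg : ContDiff ℝ 1 g) (h0 : g 0 = 0)
    {j : Fin m} (hcoop : ∀ s, 0 < partialD j g s) {Λ : ℝ} (hΛ : 0 < Λ) :
    ∃ c, 0 < c ∧ ∀ s ∈ Icc 0 Λ, c * s ≤ g (Pi.single j s) := by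
  have hcont : Continuous fun s : ℝ => partialD j g (Pi.single j s) := by
    have h1 : Continuous (fderiv ℝ g) := hg.continuous_fderiv one_ne_zero
    exact (h1.comp (continuous_single j)).clm_apply continuous_const
  obtain ⟨s₀, -, hs₀⟩ := isCompact_Icc.exists_isMinOn (nonempty_Icc.2 hΛ.le) hcont.continuousOn
  exact ⟨_, hcoop (Pi.single j s₀), fun s hs => mul_le_of_le_partialD hg h0 (fun r hr => hs₀ hr) hs⟩

end Reaction

/-! ### Lower bounds for cooperative reactions. -/

section ReactionBounds

variable {m : ℕ}

/-- Cooperative reaction terms, Lipschitz with constant `L`. -/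
structure IsCooperative (f : Fin m → (Fin m → ℝ) → ℝ) (L : ℝ) : Prop where
  zero : ∀ i, f i 0 = 0
  contDiff : ∀ i, ContDiff ℝ 1 (f i)
  partialD_pos : ∀ i j, j ≠ i → ∀ s, 0 < partialD j (f i) s
  lip_nonneg : 0 ≤ L
  lip : ∀ i s s', |f i s - f i s'| ≤ L * ‖s - s'‖

variable {f : Fin m → (Fin m → ℝ) → ℝ} {L : ℝ}

theorem IsCooperative.mono (hf : IsCooperative f L) {i : Fin m} {s s' : Fin m → ℝ} (hs : s ≤ s')
    (hi : s i = s' i) : f i s ≤ f i s' :=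
  le_of_le_of_partialD_nonneg (hf.contDiff i) (fun j hj r => (hf.partialD_pos i j hj r).le) hs hi

/-- Replacing every `s j` by `min (s j) 0` keeps the `i`-th coordinate and lowers `f i`; then
compare with `0` by the Lipschitz bound. Only negative parts remain, so the energy estimate for them
closes. -/
theorem IsCooperative.neg_mul_sum_le (hf : IsCooperative f L) {i : Fin m} {s : Fin m → ℝ}
    (hi : s i ≤ 0) : -(L * ∑ j, max (-s j) 0) ≤ f i s := by
  have h1 : f i (fun j => min (s j) 0) ≤ f i s := hf.mono (fun j => min_le_left _ _) (min_eq_left hi)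
  have h2 := hf.lip i (fun j => min (s j) 0) 0
  rw [hf.zero, sub_zero, sub_zero] at h2
  have h3 : ‖fun j => min (s j) 0‖ ≤ ∑ j, max (-s j) 0 := by
    refine (pi_norm_le_iff_of_nonneg (Finset.sum_nonneg fun j _ => le_max_right _ _)).2 fun j => ?_
    have h4 : ‖min (s j) 0‖ = max (-s j) 0 := by
      rw [Real.norm_eq_abs, abs_of_nonpos (min_le_right _ _)]
      rcases le_total (s j) 0 with h | h
      · rw [min_eq_left h, max_eq_left (by linarith)]
      · rw [min_eq_right h, max_eq_right (by linarith), neg_zero]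
    rw [h4]
    exact Finset.single_le_sum (f := fun j => max (-s j) 0) (fun j _ => le_max_right _ _)
      (Finset.mem_univ j)
  have h5 := mul_le_mul_of_nonneg_left h3 hf.lip_nonneg
  linarith [(abs_le.1 h2).1]

theorem IsCooperative.comp_single_le (hf : IsCooperative f L) {i : Fin m} {s : Fin m → ℝ}
    (hs : 0 ≤ s) : f i (Pi.single i (s i)) ≤ f i s := by
  refine hf.mono (fun j => ?_) (by simp)
  rcases eq_or_ne j i with rfl | hj
  · simp
  · rw [Pi.single_eq_of_ne hj]
    exact hs j

theorem IsCooperative.neg_mul_le (hf : IsCooperative f L) {i : Fin m} {s : Fin m → ℝ}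
    (hs : 0 ≤ s) : -L * s i ≤ f i s := by
  have h1 := hf.comp_single_le (i := i) hs
  have h2 := hf.lip i (Pi.single i (s i)) 0
  rw [hf.zero, sub_zero, sub_zero, Pi.norm_single, Real.norm_of_nonneg (hs i)] at h2
  linarith [(abs_le.1 h2).1]

/-- Setting the other coordinates to zero lowers `f i` and lands on an axis inside the box. Hence
only `s i ≤ Λ` is needed, however large the other coordinates are. -/
theorem IsCooperative.neg_mul_le_of_le (hf : IsCooperative f L) {i : Fin m} {Λ γ : ℝ}
    (hγ : ∀ s ∈ Icc (0 : Fin m → ℝ) (fun _ => Λ), |partialD i (f i) s| ≤ γ) {s : Fin m → ℝ}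
    (hs : 0 ≤ s) (hsΛ : s i ≤ Λ) : -γ * s i ≤ f i s := by
  refine (mul_le_of_le_partialD (hf.contDiff i) (hf.zero i) (j := i) (Λ := Λ) (fun r hr => ?_)
    ⟨hs i, hsΛ⟩).trans (hf.comp_single_le hs)
  refine (abs_le.1 (hγ _ ⟨fun j => ?_, fun j => ?_⟩)).1
  · rcases eq_or_ne j i with rfl | hj
    · simpa using hr.1
    · simp [Pi.single_eq_of_ne hj]
  · rcases eq_or_ne j i with rfl | hj
    · simpa using hr.2
    · simpa [Pi.single_eq_of_ne hj] using hr.1.trans hr.2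

theorem trunc_le_half {Λ : ℝ} (hΛ : 0 < Λ) (s : ℝ) : trunc Λ s ≤ Λ / 2 := by
  have : 0 ≤ max (Λ - s) 0 ^ 2 / (2 * Λ) := by positivity
  rw [trunc]
  linarith

/-- The state is lowered to `s i` and `trunc Λ (s j)` alone. Dropping `s i` costs `L * s i`, and on
the compact segment of the `j`-axis the derivative has a positive minimum. -/
theorem IsCooperative.exists_pos_mul_trunc_sub_le (hf : IsCooperative f L) {i j : Fin m}
    (hij : j ≠ i) {Λ : ℝ} (hΛ : 0 < Λ) :
    ∃ c, 0 < c ∧ ∀ s : Fin m → ℝ, 0 ≤ s → c * trunc Λ (s j) - L * s i ≤ f i s := by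
  obtain ⟨c, hc, H⟩ := exists_pos_mul_le_comp_single (hf.contDiff i) (hf.zero i)
    (hf.partialD_pos i j hij) hΛ
  refine ⟨c, hc, fun s hs => ?_⟩
  have ht0 := trunc_nonneg hΛ (hs j)
  have h1 := H (trunc Λ (s j)) ⟨ht0, (trunc_le_half hΛ _).trans (by linarith)⟩
  have h2 : f i (Pi.single i (s i) + Pi.single j (trunc Λ (s j))) ≤ f i s := by
    refine hf.mono (fun k => ?_) (by simp [Pi.single_eq_of_ne hij.symm])
    rw [Pi.add_apply]
    rcases eq_or_ne k i with rfl | hk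
    · simp [Pi.single_eq_of_ne hij.symm]
    · rw [Pi.single_eq_of_ne hk, zero_add]
      rcases eq_or_ne k j with rfl | hk'
      · simpa using trunc_le_self hΛ (s k)
      · rw [Pi.single_eq_of_ne hk']
        exact hs k
  have h3 := hf.lip i (Pi.single i (s i) + Pi.single j (trunc Λ (s j)))
    (Pi.single j (trunc Λ (s j)))
  rw [add_sub_cancel_right, Pi.norm_single, Real.norm_of_nonneg (hs i)] at h3
  linarith [(abs_le.1 h3).1]

end ReactionBounds

/-! ### Decay rate of the truncated mass and comparison with barriers. -/

section Evolution

variable {d : ℕ}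

/-- The truncated weighted mass `∫ trunc Λ (w) b`. -/
def mass (Λ q R : ℝ) (w : RealL2 d) : ℝ :=
  ∫ x, trunc Λ (w x) * barrier q R x

theorem mass_nonneg {Λ q R : ℝ} (hΛ : 0 < Λ) (hR : 0 < R) {w : RealL2 d} (hw : ∀ᵐ x, 0 ≤ w x) :
    0 ≤ mass Λ q R w :=
  integral_nonneg_of_ae <| by
    filter_upwards [hw] with x hx
    exact mul_nonneg (trunc_nonneg hΛ hx) (barrier_pos q hR x).le

theorem integrable_mass {Λ q R : ℝ} (hΛ : 0 < Λ) (hq : (d : ℝ) < q) (hR : 1 ≤ R) {w : RealL2 d}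
    (hw : ∀ᵐ x, 0 ≤ w x) : Integrable (fun x => trunc Λ (w x) * barrier q R x) volume :=
  (memLp_trunc hΛ hw).integrable_mul (memLp_barrier hq hR)

theorem integral_mul_eq_sub {p : EuclideanSpace ℝ (Fin d) → ℝ} (hp : MemLp p 2 volume)
    (V A : RealL2 d) : ∫ x, p x * V x = (∫ x, p x * (V x + A x)) - ∫ x, p x * A x := by
  have i1 : Integrable (fun x => p x * (V x + A x)) volume :=
    hp.integrable_mul ((Lp.memLp V).add (Lp.memLp A))
  have i2 : Integrable (fun x => p x * A x) volume := hp.integrable_mul (Lp.memLp A)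
  rw [← integral_sub i1 i2]
  congr 1
  ext x
  ring

theorem exp_mul_mass_le {Λ q R K ℓ t₀ t₁ : ℝ} (hΛ : 0 < Λ) (hq : (d : ℝ) < q) (hR : 1 ≤ R)
    (h01 : t₀ ≤ t₁) (hℓ : 0 ≤ ℓ) {U V A : ℝ → RealL2 d} (hc : ContinuousOn U (Icc t₀ t₁))
    (hd : ∀ s ∈ Ioo t₀ t₁, HasDerivAt U (V s) s) (h0 : ∀ s ∈ Icc t₀ t₁, ∀ᵐ x, 0 ≤ U s x)
    (hA : ∀ s ∈ Ioo t₀ t₁,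
      ∫ x, truncDeriv Λ (U s x) * barrier q R x * A s x ≤ K * mass Λ q R (U s))
    (hVA : ∀ s ∈ Ioo t₀ t₁, ∀ᵐ x, U s x ≤ Λ → -ℓ * U s x ≤ V s x + A s x) :
    Real.exp (-(K + ℓ) * (t₁ - t₀)) * mass Λ q R (U t₀) ≤ mass Λ q R (U t₁) := by
  have hR0 : 0 < R := by linarith
  refine exp_mul_le_of_neg_mul_le_deriv (N := fun s => mass Λ q R (U s)) h01
    (continuousOn_integral_trunc hΛ hq hR hc h0) (fun s hs => hasDerivAt_integral_trunc hΛ hq hR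
      (hd s hs) ?_) fun s hs => ?_
  · filter_upwards [Ioo_mem_nhds hs.1 hs.2] with r hr
    exact h0 r (Ioo_subset_Icc_self hr)
  · have hU0 := h0 s (Ioo_subset_Icc_self hs)
    have hp := memLp_truncDeriv_mul hΛ hq hR hU0
    rw [integral_mul_eq_sub hp (V s) (A s)]
    have h1 : ∫ x, -ℓ * (trunc Λ (U s x) * barrier q R x)
        ≤ ∫ x, truncDeriv Λ (U s x) * barrier q R x * (V s x + A s x) := by
      refine integral_mono_ae ((integrable_mass hΛ hq hR hU0).const_mul _)
        (hp.integrable_mul ((Lp.memLp (V s)).add (Lp.memLp (A s)))) ?_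
      filter_upwards [hU0, hVA s hs] with x hx hx2
      have hb := (barrier_pos q hR0 x).le
      have ht := truncDeriv_nonneg hΛ (U s x)
      have htm := mul_le_mul_of_nonneg_left (truncDeriv_mul_le hΛ hx) (mul_nonneg hℓ hb)
      -- Above `Λ` the derivative of the truncation vanishes, so no bound on the reaction is needed
      -- there.
      rcases le_total (U s x) Λ with h | h
      · have := mul_le_mul_of_nonneg_left (hx2 h) (mul_nonneg ht hb)
        linarith
      · rw [truncDeriv_eq_zero h] at htm ⊢
        linarith
    rw [integral_const_mul] at h1
    have h2 := hA s hs
    simp only [mass] at h2 ⊢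
    linarith

/-- The energy of the positive part of `κ b_R - U` starts at zero because `κ t₀ = 0`, and `hineq`
says that it does not increase. -/
theorem barrier_le_of_comparison {q R t₀ t₁ : ℝ} (hq : (d : ℝ) < q) (hR : 1 ≤ R)
    (h01 : t₀ ≤ t₁) {κ κ' : ℝ → ℝ} {U V A : ℝ → RealL2 d}
    (hc : ContinuousOn U (Icc t₀ t₁)) (hd : ∀ s ∈ Ioo t₀ t₁, HasDerivAt U (V s) s)
    (hκ : ∀ s, HasDerivAt κ (κ' s) s) (hκ0 : κ t₀ = 0) (hU0 : ∀ᵐ x, 0 ≤ U t₀ x)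
    (hineq : ∀ s ∈ Ioo t₀ t₁,
      κ' s * (∫ x, max (κ s * barrier q R x - U s x) 0 * barrier q R x)
        + (∫ x, max (κ s * barrier q R x - U s x) 0 * A s x)
        ≤ ∫ x, max (κ s * barrier q R x - U s x) 0 * (V s x + A s x)) :
    ∀ᵐ x, κ t₁ * barrier q R x ≤ U t₁ x := by
  have hb := memLp_barrier (d := d) hq hR
  set B : RealL2 d := hb.toLp _ with hB
  set v : ℝ → RealL2 d := fun s => κ s • B - U s with hv
  have hvx : ∀ s, ∀ᵐ x, v s x = κ s * barrier q R x - U s x := by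
    intro s
    filter_upwards [Lp.coeFn_sub (κ s • B) (U s), Lp.coeFn_smul (κ s) B, hb.coeFn_toLp]
      with x h1 h2 h3
    rw [hv]
    simp only
    rw [h1, Pi.sub_apply, h2, Pi.smul_apply, smul_eq_mul, h3]
  have hvd : ∀ s ∈ Ioo t₀ t₁, HasDerivAt v (κ' s • B - V s) s := fun s hs =>
    ((hκ s).smul_const B).sub (hd s hs)
  have hvc : ContinuousOn v (Icc t₀ t₁) :=
    (Continuous.continuousOn ((continuous_iff_continuousAt.2 fun s =>
      (hκ s).continuousAt).smul continuous_const)).sub hc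
  have hle := exp_mul_le_of_neg_mul_le_deriv (C := 0)
    (N := fun s => -∫ x, max (v s x) 0 ^ 2 / 2) h01
    (continuous_integral_posPart_sq.comp_continuousOn hvc).neg
    (fun s hs => (hasDerivAt_integral_posPart_sq (hvd s hs)).neg) fun s hs => by
      have hp : MemLp (fun x => max (κ s * barrier q R x - U s x) 0) 2 volume :=
        ((hb.const_mul (κ s)).sub (Lp.memLp (U s))).pos_part
      have i1 : Integrable (fun x => max (κ s * barrier q R x - U s x) 0 * barrier q R x) volume :=
        hp.integrable_mul hb
      have i2 : Integrable (fun x => max (κ s * barrier q R x - U s x) 0 * V s x) volume :=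
        hp.integrable_mul (Lp.memLp (V s))
      have e : ∫ x, max (v s x) 0 * (κ' s • B - V s : RealL2 d) x
          = κ' s * (∫ x, max (κ s * barrier q R x - U s x) 0 * barrier q R x)
            - ∫ x, max (κ s * barrier q R x - U s x) 0 * V s x := by
        rw [← integral_const_mul, ← integral_sub (i1.const_mul _) i2]
        refine integral_congr_ae ?_
        filter_upwards [hvx s, Lp.coeFn_sub (κ' s • B) (V s), Lp.coeFn_smul (κ' s) B,
          hb.coeFn_toLp] with x h1 h2 h3 h4
        rw [h1, h2, Pi.sub_apply, h3, Pi.smul_apply, smul_eq_mul, h4]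
        ring
      rw [e, integral_mul_eq_sub hp (V s) (A s)]
      linarith [hineq s hs]
  have hz : ∫ x, max (v t₀ x) 0 ^ 2 / 2 = 0 := by
    rw [integral_eq_zero_of_ae]
    filter_upwards [hvx t₀, hU0] with x h1 h2
    rw [h1, hκ0, max_eq_right (by linarith)]
    simp
  rw [hz, neg_zero, mul_zero] at hle
  have hnn : 0 ≤ᵐ[volume] fun x => max (v t₁ x) 0 ^ 2 / 2 := ae_of_all _ fun x => by
    simp only [Pi.zero_apply]
    positivity
  have hint : Integrable (fun x => max (v t₁ x) 0 ^ 2 / 2) volume :=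
    (Lp.memLp (v t₁)).pos_part.integrable_sq.div_const 2
  have hz1 := (integral_eq_zero_iff_of_nonneg_ae hnn hint).1
    (le_antisymm (by linarith) (integral_nonneg_of_ae hnn))
  filter_upwards [hz1, hvx t₁] with x h1 h2
  rw [h2] at h1
  have h3 : max (κ t₁ * barrier q R x - U t₁ x) 0 = 0 := by
    have : max (κ t₁ * barrier q R x - U t₁ x) 0 ^ 2 / 2 = 0 := h1
    exact pow_eq_zero_iff two_ne_zero |>.1 (by linarith)
  linarith [le_max_left (κ t₁ * barrier q R x - U t₁ x) 0]

end Evolution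

/-! ### Positivity and barrier bounds for the system. -/

section System

variable {d m : ℕ}

/-- The `L²` form of the evolution system, without the continuous representative. -/
structure IsStrongSolution (α : Fin m → ℝ) (f : Fin m → (Fin m → ℝ) → ℝ)
    (U V A : Fin m → ℝ → RealL2 d) : Prop where
  continuousOn : ∀ i, ContinuousOn (U i) (Ici 0)
  hasDerivAt : ∀ i, ∀ t, 0 < t → HasDerivAt (U i) (V i t) t
  fracLaplacian : ∀ i, ∀ t, 0 < t → IsFracLaplacian (α i) (U i t) (A i t)
  eq : ∀ i, ∀ t, 0 < t → ∀ᵐ x, V i t x + A i t x = f i (fun j => U j t x)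

variable {α : Fin m → ℝ} {f : Fin m → (Fin m → ℝ) → ℝ} {U V A : Fin m → ℝ → RealL2 d} {L : ℝ}

theorem integral_negPart_mul_nonpos (hd : 1 ≤ d) {a : ℝ} (ha : 0 < a) (ha1 : a ≤ 1)
    {w g : RealL2 d} (hwg : IsFracLaplacian a w g) : ∫ x, max (-w x) 0 * g x ≤ 0 := by
  obtain ⟨K, -, H⟩ := exists_integral_posPart_mul_le (q := d + 1) hd ha ha1 (by linarith)
  -- With `κ = 0` the barrier disappears and the right side is zero, so the choice `q = d + 1` is
  -- immaterial.
  simpa using H w g hwg 1 0 le_rfl le_rfl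

theorem IsStrongSolution.integral_negPart_mul_le (hd : 1 ≤ d)
    (hα : ∀ i, 0 < α i ∧ α i ≤ 1) (hf : IsCooperative f L) (h : IsStrongSolution α f U V A)
    (i : Fin m) {s : ℝ} (hs : 0 < s) :
    -∫ x, max (-U i s x) 0 * V i s x
      ≤ L * ∑ j, ((∫ x, max (-U i s x) 0 ^ 2 / 2) + ∫ x, max (-U j s x) 0 ^ 2 / 2) := by
  have hp : ∀ j, MemLp (fun x => max (-U j s x) 0) 2 volume := fun j =>
    (Lp.memLp (U j s)).neg.pos_part
  have hsq : ∀ j, Integrable (fun x => max (-U j s x) 0 ^ 2 / 2) volume := fun j =>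
    (hp j).integrable_sq.div_const 2
  have hadd : ∀ j, Integrable (fun x => max (-U i s x) 0 ^ 2 / 2 + max (-U j s x) 0 ^ 2 / 2)
      volume := fun j => (hsq i).add (hsq j)
  have h1 := integral_negPart_mul_nonpos hd (hα i).1 (hα i).2 (h.fracLaplacian i s hs)
  have h2 : ∫ x, -(L * ∑ j, (max (-U i s x) 0 ^ 2 / 2 + max (-U j s x) 0 ^ 2 / 2))
      ≤ ∫ x, max (-U i s x) 0 * (V i s x + A i s x) := by
    refine integral_mono_ae ((integrable_finsetSum _ fun j _ =>
      hadd j).const_mul L).neg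
      ((hp i).integrable_mul ((Lp.memLp (V i s)).add (Lp.memLp (A i s)))) ?_
    filter_upwards [h.eq i s hs] with x hx
    rw [hx]
    have hps : ∑ j, max (-U i s x) 0 * max (-U j s x) 0
        ≤ ∑ j, (max (-U i s x) 0 ^ 2 / 2 + max (-U j s x) 0 ^ 2 / 2) :=
      Finset.sum_le_sum fun j _ => by
        nlinarith [sq_nonneg (max (-U i s x) 0 - max (-U j s x) 0)]
    have hps' := mul_le_mul_of_nonneg_left hps hf.lip_nonneg
    rw [← Finset.mul_sum] at hps'
    rcases le_total (U i s x) 0 with h0 | h0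
    · have h3 := mul_le_mul_of_nonneg_left (hf.neg_mul_sum_le (s := fun j => U j s x) h0)
        (le_max_right (-U i s x) 0)
      linarith
    · rw [max_eq_right (by linarith : -U i s x ≤ 0), zero_mul] at hps'
      rw [max_eq_right (by linarith : -U i s x ≤ 0), zero_mul]
      linarith
  rw [integral_neg, integral_const_mul, integral_finsetSum _ fun j _ => hadd j] at h2
  simp only [integral_add (hsq i) (hsq _)] at h2
  rw [integral_mul_eq_sub (hp i) (V i s) (A i s)]
  linarith

/-- Gronwall for the sum over all components of the energies of the negative parts, since each one
is controlled only by all of them. -/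
theorem IsStrongSolution.nonneg (hd : 1 ≤ d) (hα : ∀ i, 0 < α i ∧ α i ≤ 1)
    (hf : IsCooperative f L) (h : IsStrongSolution α f U V A) (h0 : ∀ i, ∀ᵐ x, 0 ≤ U i 0 x)
    {t : ℝ} (ht : 0 ≤ t) (i : Fin m) : ∀ᵐ x, 0 ≤ U i t x := by
  set φ : Fin m → ℝ → ℝ := fun i s => ∫ x, max (-U i s x) 0 ^ 2 / 2 with hφ
  have hφe : ∀ i s, ∫ x, max ((-U i s : RealL2 d) x) 0 ^ 2 / 2 = φ i s := fun i s => by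
    refine integral_congr_ae ?_
    filter_upwards [Lp.coeFn_neg (U i s)] with x hx
    rw [hx, Pi.neg_apply]
  have hφd : ∀ i s, 0 < s → HasDerivAt (φ i) (-∫ x, max (-U i s x) 0 * V i s x) s := by
    intro i s hs
    have h1 := hasDerivAt_integral_posPart_sq (h.hasDerivAt i s hs).neg
    simp only [Pi.neg_apply, hφe] at h1
    convert h1 using 1
    rw [← integral_neg]
    refine integral_congr_ae ?_
    filter_upwards [Lp.coeFn_neg (U i s), Lp.coeFn_neg (V i s)] with x hx hy
    rw [hx, hy, Pi.neg_apply, Pi.neg_apply, mul_neg]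
  have hφc : ∀ i, ContinuousOn (φ i) (Icc 0 t) := fun i => by
    have h1 := continuous_integral_posPart_sq.comp_continuousOn
      ((h.continuousOn i).mono fun s (hs : s ∈ Icc 0 t) => hs.1).neg
    refine h1.congr fun s _ => ?_
    exact (hφe i s).symm
  have hφ0 : ∀ i s, 0 ≤ φ i s := fun i s => integral_nonneg fun x => by positivity
  have hle := exp_mul_le_of_neg_mul_le_deriv (C := -(2 * L * m)) (N := fun s => -∑ i, φ i s) ht
    (continuousOn_finsetSum _ fun i _ => hφc i).neg
    (fun s hs => (HasDerivAt.fun_sum fun i _ => hφd i s hs.1).neg) fun s hs => by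
      have h1 : ∑ i, -∫ x, max (-U i s x) 0 * V i s x
          ≤ ∑ i, L * ∑ j, (φ i s + φ j s) := Finset.sum_le_sum fun i _ =>
        h.integral_negPart_mul_le hd hα hf i hs.1
      have h2 : ∑ i, L * ∑ j, (φ i s + φ j s) = 2 * L * m * ∑ i, φ i s := by
        simp only [Finset.sum_add_distrib, ← Finset.mul_sum, Finset.sum_const, Finset.card_univ,
          Fintype.card_fin, nsmul_eq_mul]
        ring
      linarith
  have hz : ∀ j, φ j 0 = 0 := fun j => by
    refine integral_eq_zero_of_ae ?_
    filter_upwards [h0 j] with x hx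
    rw [max_eq_right (by linarith)]
    simp
  simp only [hz, Finset.sum_const_zero, neg_zero, mul_zero] at hle
  have hi0 : φ i t = 0 := le_antisymm
    ((Finset.single_le_sum (f := fun i => φ i t) (fun j _ => hφ0 j t) (Finset.mem_univ i)).trans
      (by linarith)) (hφ0 i t)
  have hint : Integrable (fun x => max (-U i t x) 0 ^ 2 / 2) volume :=
    (Lp.memLp (U i t)).neg.pos_part.integrable_sq.div_const 2
  have hae := (integral_eq_zero_iff_of_nonneg_ae (ae_of_all _ fun x => by
    simp only [Pi.zero_apply]
    positivity) hint).1 hi0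
  filter_upwards [hae] with x hx
  have h3 : max (-U i t x) 0 ^ 2 / 2 = 0 := hx
  have h4 : max (-U i t x) 0 = 0 := pow_eq_zero_iff two_ne_zero |>.1 (by linarith)
  linarith [le_max_left (-U i t x) 0]

theorem IsStrongSolution.ae_nonneg_pi (h0 : ∀ i, ∀ s, 0 ≤ s → ∀ᵐ x, 0 ≤ U i s x) {s : ℝ}
    (hs : 0 ≤ s) : ∀ᵐ x, (0 : Fin m → ℝ) ≤ fun j => U j s x := by
  have := ae_all_iff.2 fun j => h0 j s hs
  filter_upwards [this] with x hx
  exact hx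

theorem mass_pos_of_not_ae_zero {Λ q R : ℝ} (hΛ : 0 < Λ) (hq : (d : ℝ) < q) (hR : 1 ≤ R)
    {w : RealL2 d} (hw : ∀ᵐ x, 0 ≤ w x) (hne : ¬ ∀ᵐ x, w x = 0) : 0 < mass Λ q R w := by
  have hR0 : 0 < R := by linarith
  refine lt_of_le_of_ne (mass_nonneg hΛ hR0 hw) fun h => hne ?_
  have hnn : 0 ≤ᵐ[volume] fun x => trunc Λ (w x) * barrier q R x := by
    filter_upwards [hw] with x hx
    exact mul_nonneg (trunc_nonneg hΛ hx) (barrier_pos q hR0 x).le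
  have := (integral_eq_zero_iff_of_nonneg_ae hnn (integrable_mass hΛ hq hR hw)).1 h.symm
  filter_upwards [hw, this] with x hx h1
  by_contra h2
  exact (mul_pos (trunc_pos hΛ (lt_of_le_of_ne hx (Ne.symm h2))) (barrier_pos q hR0 x)).ne' h1

theorem ae_zero_of_mass_nonpos {Λ q R : ℝ} (hΛ : 0 < Λ) (hq : (d : ℝ) < q) (hR : 1 ≤ R)
    {w : RealL2 d} (hw : ∀ᵐ x, 0 ≤ w x) (hm : mass Λ q R w ≤ 0) : ∀ᵐ x, w x = 0 := by
  by_contra h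
  exact absurd (mass_pos_of_not_ae_zero hΛ hq hR hw h) (not_lt.2 hm)

theorem IsStrongSolution.exists_exp_mul_mass_le (hd : 1 ≤ d) (hα : ∀ i, 0 < α i ∧ α i ≤ 1)
    (hf : IsCooperative f L) (h : IsStrongSolution α f U V A)
    (h0 : ∀ i, ∀ s, 0 ≤ s → ∀ᵐ x, 0 ≤ U i s x) {Λ q R : ℝ} (hΛ : 0 < Λ) (hq : (d : ℝ) < q)
    (hR : 1 ≤ R) (i : Fin m) :
    ∃ C, ∀ t₀ t₁, 0 ≤ t₀ → t₀ ≤ t₁ →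
      Real.exp (-C * (t₁ - t₀)) * mass Λ q R (U i t₀) ≤ mass Λ q R (U i t₁) := by
  obtain ⟨K, -, H⟩ := exists_integral_concave_mul_le hd (hα i).1 (hα i).2 hq
  refine ⟨K + L, fun t₀ t₁ ht₀ ht => ?_⟩
  refine exp_mul_mass_le (V := V i) (A := A i) hΛ hq hR ht hf.lip_nonneg
    ((h.continuousOn i).mono (Icc_subset_Ici_self.trans (Ici_subset_Ici.2 ht₀)))
    (fun s hs => h.hasDerivAt i s (ht₀.trans_lt hs.1)) (fun s hs => h0 i s (ht₀.trans hs.1))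
    (fun s hs => ?_) fun s hs => ?_
  · have hs0 : 0 < s := ht₀.trans_lt hs.1
    have hU := h0 i s hs0.le
    refine H (U i s) (A i s) (h.fracLaplacian i s hs0) (trunc Λ) (truncDeriv Λ) R hR
      (trunc_le_add hΛ) (memLp_trunc hΛ hU) ?_ (memLp_truncDeriv_mul hΛ hq hR hU)
    filter_upwards [hU] with x hx
    exact trunc_nonneg hΛ hx
  · have hs0 : 0 < s := ht₀.trans_lt hs.1
    filter_upwards [h.eq i s hs0, IsStrongSolution.ae_nonneg_pi h0 hs0.le] with x hx hx0 _
    rw [hx]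
    exact hf.neg_mul_le hx0

/-- The initially nonzero component keeps positive mass by the exponential bound. If another had
none at time `t`, the same bound read backwards would make its mass vanish on `[0, t]`; but its
derivative at `t/2` is at least a positive multiple of the mass of the nonzero one. -/
theorem IsStrongSolution.mass_pos (hd : 1 ≤ d) (hα : ∀ i, 0 < α i ∧ α i ≤ 1)
    (hf : IsCooperative f L) (h : IsStrongSolution α f U V A)
    (h0 : ∀ i, ∀ s, 0 ≤ s → ∀ᵐ x, 0 ≤ U i s x) {Λ q : ℝ} (hΛ : 0 < Λ) (hq : (d : ℝ) < q)
    {i₀ : Fin m} (hne : ¬ ∀ᵐ x, U i₀ 0 x = 0) (i : Fin m) {t : ℝ} (ht : 0 < t) :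
    0 < mass Λ q 1 (U i t) := by
  have hi₀ : ∀ s, 0 ≤ s → 0 < mass Λ q 1 (U i₀ s) := by
    intro s hs
    obtain ⟨C, hC⟩ := h.exists_exp_mul_mass_le hd hα hf h0 hΛ hq le_rfl i₀
    exact (mul_pos (Real.exp_pos _) (mass_pos_of_not_ae_zero hΛ hq le_rfl (h0 i₀ 0 le_rfl) hne)).trans_le
      (hC 0 s le_rfl hs)
  rcases eq_or_ne i₀ i with rfl | hi
  · exact hi₀ t ht.le
  by_contra hcon
  obtain ⟨C, hC⟩ := h.exists_exp_mul_mass_le hd hα hf h0 hΛ hq le_rfl i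
  have hzero : ∀ s, 0 ≤ s → s ≤ t → mass Λ q 1 (U i s) = 0 := by
    intro s hs hst
    refine le_antisymm ?_ (mass_nonneg hΛ one_pos (h0 i s hs))
    have h1 := (hC s t hs hst).trans (not_lt.1 hcon)
    by_contra h2
    exact absurd (mul_pos (Real.exp_pos (-C * (t - s))) (not_le.1 h2)) (not_lt.2 h1)
  set s : ℝ := t / 2 with hsdef
  have hs0 : 0 < s := by positivity
  have hst : s < t := half_lt_self ht
  have hU0 : ∀ᵐ x, U i s x = 0 :=
    ae_zero_of_mass_nonpos hΛ hq le_rfl (h0 i s hs0.le) (hzero s hs0.le hst.le).le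
  have hev : ∀ᶠ r in nhds s, ∀ᵐ x, 0 ≤ U i r x := by
    filter_upwards [Ioo_mem_nhds hs0 hst] with r hr
    exact h0 i r hr.1.le
  have hder := hasDerivAt_integral_trunc hΛ hq le_rfl (h.hasDerivAt i s hs0) hev
  have hder0 : HasDerivAt (fun r => ∫ x, trunc Λ (U i r x) * barrier q 1 x) 0 s := by
    refine (hasDerivAt_const s (0 : ℝ)).congr_of_eventuallyEq ?_
    filter_upwards [Ioo_mem_nhds hs0 hst] with r hr
    exact hzero r hr.1.le hr.2.le
  have hval := hder.unique hder0
  have hp := memLp_truncDeriv_mul hΛ hq le_rfl (h0 i s hs0.le)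
  rw [integral_mul_eq_sub hp (V i s) (A i s)] at hval
  obtain ⟨K, -, H⟩ := exists_integral_concave_mul_le hd (hα i).1 (hα i).2 hq
  have hA := H (U i s) (A i s) (h.fracLaplacian i s hs0) (trunc Λ) (truncDeriv Λ) 1 le_rfl
    (trunc_le_add hΛ) (memLp_trunc hΛ (h0 i s hs0.le))
    (by filter_upwards [h0 i s hs0.le] with x hx using trunc_nonneg hΛ hx) hp
  have hm0 : ∫ x, trunc Λ (U i s x) * barrier q 1 x = 0 := hzero s hs0.le hst.le
  rw [hm0, mul_zero] at hA
  obtain ⟨c, hc, hcf⟩ := hf.exists_pos_mul_trunc_sub_le hi hΛ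
  have hlow : ∫ x, c * (trunc Λ (U i₀ s x) * barrier q 1 x)
      ≤ ∫ x, truncDeriv Λ (U i s x) * barrier q 1 x * (V i s x + A i s x) := by
    refine integral_mono_ae ((integrable_mass hΛ hq le_rfl (h0 i₀ s hs0.le)).const_mul c)
      (hp.integrable_mul ((Lp.memLp (V i s)).add (Lp.memLp (A i s)))) ?_
    filter_upwards [hU0, h.eq i s hs0, IsStrongSolution.ae_nonneg_pi h0 hs0.le] with x h1 h2 h3
    rw [h2, h1, truncDeriv_zero hΛ, one_mul]
    have h4 := hcf _ h3
    simp only [h1, mul_zero, sub_zero] at h4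
    linarith [mul_le_mul_of_nonneg_left h4 (barrier_pos q one_pos x).le]
  rw [integral_const_mul] at hlow
  have := mul_pos hc (hi₀ s hs0.le)
  simp only [mass] at this
  linarith

theorem mass_barrier_ge {Λ q R : ℝ} (hΛ : 0 < Λ) (hq : (d : ℝ) < q) (hR : 1 ≤ R) {w : RealL2 d}
    (hw : ∀ᵐ x, 0 ≤ w x) : R ^ (-q) * mass Λ q 1 w ≤ mass Λ q R w := by
  have hq0 : 0 ≤ q := (Nat.cast_nonneg d).trans hq.le
  rw [mass, mass, ← integral_const_mul]
  refine integral_mono_ae ((integrable_mass hΛ hq le_rfl hw).const_mul _)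
    (integrable_mass hΛ hq hR hw) ?_
  filter_upwards [hw] with x hx
  have := mul_le_mul_of_nonneg_left (barrier_ge hq0 hR x) (trunc_nonneg hΛ hx)
  linarith

theorem mass_le_integral {Λ q R : ℝ} (hΛ : 0 < Λ) (hq : (d : ℝ) < q) (hR : 1 ≤ R) {w : RealL2 d}
    (hw : ∀ᵐ x, 0 ≤ w x) : mass Λ q R w ≤ ∫ x, w x * barrier q R x := by
  refine integral_mono_ae (integrable_mass hΛ hq hR hw)
    ((Lp.memLp w).integrable_mul (memLp_barrier hq hR)) (ae_of_all _ fun x => ?_)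
  exact mul_le_mul_of_nonneg_right (trunc_le_self hΛ _) (barrier_pos q (by linarith) x).le

theorem mul_exp_neg_mul_le {γ y : ℝ} (hγ : 0 < γ) : y * Real.exp (-γ * y) ≤ 1 / γ := by
  rw [le_div_iff₀ hγ, neg_mul, Real.exp_neg]
  have h1 := Real.add_one_le_exp (γ * y)
  have h2 := Real.exp_pos (γ * y)
  rw [mul_assoc, mul_comm (Real.exp (γ * y))⁻¹, ← mul_assoc, ← div_eq_mul_inv, div_le_one h2]
  linarith

theorem integral_posPart_mul_barrier_nonneg {q R : ℝ} (hR : 0 < R)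
    (v : EuclideanSpace ℝ (Fin d) → ℝ) : 0 ≤ ∫ x, max (v x) 0 * barrier q R x :=
  integral_nonneg fun x => mul_nonneg (le_max_right _ _) (barrier_pos q hR x).le

/-- The bound on a whole interval of times and the bound by `Λ` are what
`exists_barrier_le_of_source` asks of its source. -/
theorem IsStrongSolution.exists_barrier_le_last (hd : 1 ≤ d) (hα : ∀ i, 0 < α i ∧ α i ≤ 1)
    (h : IsStrongSolution α f U V A)
    (h0 : ∀ i, ∀ s, 0 ≤ s → ∀ᵐ x, 0 ≤ U i s x) {Λ γ : ℝ} (hΛ : 0 < Λ) (hγ : 0 < γ)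
    {i : Fin m} (hi : α i < 1)
    (hfγ : ∀ s : Fin m → ℝ, 0 ≤ s → s i ≤ Λ → -γ * s i ≤ f i s)
    (hpos : 0 < mass Λ (d + 2 * α i) 1 (U i (1 / 4))) :
    ∃ c, 0 < c ∧ ∀ T, 1 ≤ T → c * T * Real.exp (-γ * T) ≤ Λ ∧ ∀ s ∈ Icc (T - 1 / 2) T, ∀ᵐ x,
      c * T * Real.exp (-γ * T) * barrier (d + 2 * α i) (T ^ (1 / (2 * α i))) x ≤ U i s x := by
  have ha := (hα i).1
  set q : ℝ := (d : ℝ) + 2 * α i with hqd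
  have hq : (d : ℝ) < q := by linarith
  have hq0 : 0 ≤ q := by positivity
  obtain ⟨K₁, k, hK₁, hk, H₁⟩ := exists_integral_posPart_mul_le_scaled hd ha hi
  obtain ⟨K₂, hK₂, H₂⟩ := exists_integral_concave_mul_le_scaled hd ha hi
  rw [← hqd] at H₁ H₂
  set n₀ : ℝ := mass Λ q 1 (U i (1 / 4)) with hn₀
  -- `k * n₀` is the available jump gain; `Λ * γ` keeps `κ ≤ Λ`, since `y e^{-γy} ≤ 1/γ`.
  set a₀ : ℝ := min (k * n₀) (Λ * γ) with ha₀
  have ha₀pos : 0 < a₀ := lt_min (by positivity) (by positivity)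
  set K : ℝ := K₁ + K₂ with hK
  refine ⟨a₀ / 4 * Real.exp (-K), by positivity, fun T hT => ?_⟩
  have hT0 : 0 < T := by linarith
  set R : ℝ := T ^ (1 / (2 * α i)) with hR
  have hR1 : 1 ≤ R := Real.one_le_rpow hT (by positivity)
  have hR0 : 0 < R := by linarith
  have hRa : R ^ (-(2 * α i)) = T⁻¹ := by
    rw [hR, ← Real.rpow_mul hT0.le, ← Real.rpow_neg_one]
    congr 1
    field_simp
  set ρ : ℝ := γ + K / T with hρ
  set κ : ℝ → ℝ := fun s => a₀ * (s - 1 / 4) * Real.exp (-ρ * (s - 1 / 4)) with hκ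
  have hκd : ∀ s, HasDerivAt κ (a₀ * Real.exp (-ρ * (s - 1 / 4)) - ρ * κ s) s := by
    intro s
    have h1 : HasDerivAt (fun s : ℝ => a₀ * (s - 1 / 4)) (a₀ * 1) s :=
      ((hasDerivAt_id s).sub_const _).const_mul a₀
    have h2 : HasDerivAt (fun s : ℝ => Real.exp (-ρ * (s - 1 / 4)))
        (Real.exp (-ρ * (s - 1 / 4)) * (-ρ * 1)) s :=
      (((hasDerivAt_id s).sub_const _).const_mul (-ρ)).exp
    refine (h1.mul h2).congr_deriv ?_
    rw [hκ]
    ring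
  have hκΛ : ∀ s, 1 / 4 ≤ s → κ s ≤ Λ := by
    intro s hs
    have hs' : 0 ≤ s - 1 / 4 := by linarith
    have e1 : Real.exp (-ρ * (s - 1 / 4)) ≤ Real.exp (-γ * (s - 1 / 4)) := by
      refine Real.exp_le_exp.2 ?_
      have : 0 ≤ K / T * (s - 1 / 4) := by positivity
      rw [hρ]
      linarith
    have e2 := mul_exp_neg_mul_le (y := s - 1 / 4) hγ
    calc κ s ≤ (Λ * γ) * (s - 1 / 4) * Real.exp (-γ * (s - 1 / 4)) := by
          rw [hκ]
          simp only
          gcongr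
          exact min_le_right _ _
      _ = (Λ * γ) * ((s - 1 / 4) * Real.exp (-γ * (s - 1 / 4))) := by ring
      _ ≤ (Λ * γ) * (1 / γ) := by gcongr
      _ = Λ := by field_simp
  have hκnn : ∀ s, 1 / 4 ≤ s → 0 ≤ κ s := fun s hs =>
    mul_nonneg (mul_nonneg ha₀pos.le (by linarith)) (Real.exp_pos _).le
  have hmass : ∀ s, 1 / 4 ≤ s → s ≤ T →
      R ^ (-q) * n₀ * Real.exp (-ρ * (s - 1 / 4)) ≤ ∫ x, U i s x * barrier q R x := by
    intro s hs hsT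
    have h1 := exp_mul_mass_le (K := K₂ * T⁻¹) (ℓ := γ) (U := U i) (V := V i) (A := A i) hΛ hq hR1
      hs hγ.le ((h.continuousOn i).mono (Icc_subset_Ici_self.trans
        (Ici_subset_Ici.2 (by norm_num))))
      (fun r hr => h.hasDerivAt i r (lt_trans (by norm_num) hr.1))
      (fun r hr => h0 i r (le_trans (by norm_num) hr.1)) (fun r hr => by
        have hr0 : 0 < r := lt_trans (by norm_num) hr.1
        have hU := h0 i r hr0.le
        have h2 := H₂ (U i r) (A i r) (h.fracLaplacian i r hr0) (trunc Λ) (truncDeriv Λ) R hR1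
          (trunc_le_add hΛ) (memLp_trunc hΛ hU)
          (by filter_upwards [hU] with x hx using trunc_nonneg hΛ hx)
          (memLp_truncDeriv_mul hΛ hq hR1 hU)
        rwa [hRa] at h2) (fun r hr => by
        have hr0 : 0 < r := lt_trans (by norm_num) hr.1
        filter_upwards [h.eq i r hr0, IsStrongSolution.ae_nonneg_pi h0 hr0.le] with x hx hx0 hxΛ
        rw [hx]
        exact hfγ _ hx0 hxΛ)
    have h3 := mass_barrier_ge hΛ hq hR1 (h0 i (1 / 4) (by norm_num))
    have h4 := mass_le_integral hΛ hq hR1 (h0 i s (le_trans (by norm_num) hs))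
    have h5 : Real.exp (-ρ * (s - 1 / 4)) ≤ Real.exp (-(K₂ * T⁻¹ + γ) * (s - 1 / 4)) := by
      refine Real.exp_le_exp.2 ?_
      have : 0 ≤ K₁ * T⁻¹ * (s - 1 / 4) := mul_nonneg (by positivity) (by linarith)
      rw [hρ, hK, div_eq_mul_inv]
      linarith
    calc R ^ (-q) * n₀ * Real.exp (-ρ * (s - 1 / 4))
        ≤ mass Λ q R (U i (1 / 4)) * Real.exp (-(K₂ * T⁻¹ + γ) * (s - 1 / 4)) := by
          gcongr
          exact (mul_nonneg (by positivity) hpos.le).trans h3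
      _ ≤ _ := by
          rw [mul_comm]
          exact h1.trans h4
  have hcomp : ∀ t, 1 / 4 ≤ t → t ≤ T → ∀ᵐ x, κ t * barrier q R x ≤ U i t x := by
    intro t ht htT
    refine barrier_le_of_comparison (V := V i) (A := A i) hq hR1 ht
      ((h.continuousOn i).mono (Icc_subset_Ici_self.trans (Ici_subset_Ici.2 (by norm_num))))
      (fun r hr => h.hasDerivAt i r (lt_trans (by norm_num) hr.1)) hκd (by rw [hκ]; simp)
      (h0 i _ (by norm_num)) fun s hs => ?_
    have hs0 : 0 < s := lt_trans (by norm_num) hs.1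
    have hU := h0 i s hs0.le
    have hp : MemLp (fun x => max (κ s * barrier q R x - U i s x) 0) 2 volume :=
      (((memLp_barrier hq hR1).const_mul (κ s)).sub (Lp.memLp (U i s))).pos_part
    have hpb : Integrable (fun x => max (κ s * barrier q R x - U i s x) 0 * barrier q R x) volume :=
      hp.integrable_mul (memLp_barrier hq hR1)
    have hPnn := integral_posPart_mul_barrier_nonneg (q := q) hR0
      (fun x => κ s * barrier q R x - U i s x)
    have h1 := H₁ (U i s) (A i s) (h.fracLaplacian i s hs0) hU R (κ s) hR1 (hκnn s hs.1.le)
    have e1 : ∀ x : EuclideanSpace ℝ (Fin d), max (κ s * barrier q R x - U i s x) 0 *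
        (κ s * barrier q R x) = κ s * (max (κ s * barrier q R x - U i s x) 0 * barrier q R x) :=
      fun x => by ring
    have h2 : ∫ x, -(γ * κ s) * (max (κ s * barrier q R x - U i s x) 0 * barrier q R x)
        ≤ ∫ x, max (κ s * barrier q R x - U i s x) 0 * (V i s x + A i s x) := by
      refine integral_mono_ae (hpb.const_mul _)
        (hp.integrable_mul ((Lp.memLp (V i s)).add (Lp.memLp (A i s)))) ?_
      filter_upwards [h.eq i s hs0, IsStrongSolution.ae_nonneg_pi h0 hs0.le] with x hx hx0
      rw [hx]
      rcases le_total (κ s * barrier q R x - U i s x) 0 with hle | hle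
      · rw [max_eq_right hle]
        simp
      · rw [max_eq_left hle]
        have hUx : U i s x ≤ κ s * barrier q R x := by linarith
        have hUΛ : U i s x ≤ Λ := hUx.trans ((mul_le_of_le_one_right (hκnn s hs.1.le)
          (barrier_le_one hq0 hR1 x)).trans (hκΛ s hs.1.le))
        have h3 := mul_le_mul_of_nonneg_left (hfγ _ hx0 hUΛ) hle
        have h4 := mul_le_mul_of_nonneg_left hUx (mul_nonneg hγ.le hle)
        linarith
    rw [integral_const_mul] at h2
    simp only [e1] at h1
    rw [integral_const_mul, hRa] at h1
    have h5 := hmass s hs.1.le (hs.2.le.trans htT)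
    have hRq : R ^ q * R ^ (-q) = 1 := by
      rw [← Real.rpow_add hR0, add_neg_cancel, Real.rpow_zero]
    set P : ℝ := ∫ x, max (κ s * barrier q R x - U i s x) 0 * barrier q R x with hP
    set M : ℝ := ∫ x, U i s x * barrier q R x with hM
    -- The factor `R^q` of the jump gain cancels the `R^(-q)` lost in comparing the initial mass for
    -- `b_R` with that for `b_1`.
    have h6 : k * n₀ * Real.exp (-ρ * (s - 1 / 4)) * P ≤ k * R ^ q * P * M := by
      have h7 := mul_le_mul_of_nonneg_left h5 (by positivity : 0 ≤ k * R ^ q * P)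
      calc k * n₀ * Real.exp (-ρ * (s - 1 / 4)) * P
          = k * (R ^ q * R ^ (-q)) * P * (n₀ * Real.exp (-ρ * (s - 1 / 4))) := by
            rw [hRq]
            ring
        _ = k * R ^ q * P * (R ^ (-q) * n₀ * Real.exp (-ρ * (s - 1 / 4))) := by ring
        _ ≤ _ := h7
    have h8 : a₀ * Real.exp (-ρ * (s - 1 / 4)) * P ≤ k * n₀ * Real.exp (-ρ * (s - 1 / 4)) * P := by
      gcongr
      exact min_le_left _ _
    have h9 : 0 ≤ K₂ * T⁻¹ * (κ s * P) :=
      mul_nonneg (by positivity) (mul_nonneg (hκnn s hs.1.le) hPnn)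
    have e2 : ρ = γ + (K₁ + K₂) * T⁻¹ := by rw [hρ, hK, div_eq_mul_inv]
    rw [e2] at h6 h8 ⊢
    linarith
  -- For `s ≥ T - 1/2` and `T ≥ 1` one has `s - 1/4 ≥ T/4`, while `ρ T = γ T + K`.
  have hlow : ∀ s ∈ Icc (T - 1 / 2) T, a₀ / 4 * Real.exp (-K) * T * Real.exp (-γ * T) ≤ κ s := by
    intro s hs
    have e1 : Real.exp (-K) * Real.exp (-γ * T) ≤ Real.exp (-ρ * (s - 1 / 4)) := by
      rw [← Real.exp_add]
      refine Real.exp_le_exp.2 ?_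
      have h1 : ρ * (s - 1 / 4) ≤ ρ * T :=
        mul_le_mul_of_nonneg_left (by linarith [hs.2]) (by positivity)
      have h2 : ρ * T = γ * T + K := by
        rw [hρ]
        field_simp
      linarith
    calc a₀ / 4 * Real.exp (-K) * T * Real.exp (-γ * T)
        = a₀ * (T / 4) * (Real.exp (-K) * Real.exp (-γ * T)) := by ring
      _ ≤ a₀ * (s - 1 / 4) * Real.exp (-ρ * (s - 1 / 4)) := by
        gcongr
        · exact mul_nonneg ha₀pos.le (by linarith [hs.1])
        · linarith [hs.1]
  refine ⟨(hlow T ⟨by linarith, le_rfl⟩).trans (hκΛ T (by linarith)), fun s hs => ?_⟩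
  filter_upwards [hcomp s (by linarith [hs.1]) hs.2] with x hx
  exact (mul_le_mul_of_nonneg_right (hlow s hs) (barrier_pos q hR0 x).le).trans hx

theorem half_le_trunc {Λ w u : ℝ} (hΛ : 0 < Λ) (hw : 0 ≤ w) (hwΛ : w ≤ Λ) (hwu : w ≤ u) :
    w / 2 ≤ trunc Λ u := by
  have h1 : max (Λ - u) 0 ≤ Λ - w := max_le (by linarith) (by linarith)
  have h2 : max (Λ - u) 0 ^ 2 ≤ (Λ - w) ^ 2 := pow_le_pow_left₀ (le_max_right _ _) h1 2
  have h3 : max (Λ - u) 0 ^ 2 / (2 * Λ) ≤ Λ / 2 - w / 2 := by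
    rw [div_le_iff₀ (by positivity)]
    nlinarith
  rw [trunc]
  linarith

/-- A linear ramp times the source's own barrier is a subsolution, because diffusion of any order `≤
1` costs at most `K b_R` with `K` independent of `R ≥ 1`. -/
theorem IsStrongSolution.exists_barrier_le_of_source (hd : 1 ≤ d) (hα : ∀ i, 0 < α i ∧ α i ≤ 1)
    (hf : IsCooperative f L) (h : IsStrongSolution α f U V A)
    (h0 : ∀ i, ∀ s, 0 ≤ s → ∀ᵐ x, 0 ≤ U i s x) {Λ q : ℝ} (hΛ : 0 < Λ) (hq : (d : ℝ) < q)
    {i j : Fin m} (hij : j ≠ i) :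
    ∃ c, 0 < c ∧ ∀ T R ω : ℝ, 1 ≤ T → 1 ≤ R → 0 ≤ ω → ω ≤ Λ →
      (∀ s ∈ Icc (T - 1 / 2) T, ∀ᵐ x, ω * barrier q R x ≤ U j s x) →
      ∀ᵐ x, c * ω * barrier q R x ≤ U i T x := by
  have hq0 : 0 ≤ q := (Nat.cast_nonneg d).trans hq.le
  obtain ⟨K, hK, H⟩ := exists_integral_posPart_mul_le hd (hα i).1 (hα i).2 hq
  obtain ⟨c, hc, hcf⟩ := hf.exists_pos_mul_trunc_sub_le hij hΛ
  have hL := hf.lip_nonneg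
  -- Chosen so that slope plus losses at the maximal height `κ₀ ω / 2` equals the source: `κ₀ ω + (K
  -- + L) κ₀ ω / 2 = c ω / 2`.
  set κ₀ : ℝ := c / (2 + K + L) with hκ₀
  have hκ₀pos : 0 < κ₀ := by positivity
  have hκ₀e : κ₀ * (2 + K + L) = c := by rw [hκ₀]; field_simp
  refine ⟨κ₀ / 2, by positivity, fun T R ω hT hR hω hωΛ hsrc => ?_⟩
  have hR0 : 0 < R := by linarith
  set κ : ℝ → ℝ := fun s => κ₀ * ω * (s - (T - 1 / 2)) with hκ
  have hκd : ∀ s, HasDerivAt κ (κ₀ * ω) s := fun s => by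
    have h1 : HasDerivAt κ (κ₀ * ω * 1) s := ((hasDerivAt_id s).sub_const _).const_mul (κ₀ * ω)
    rwa [mul_one] at h1
  have hcomp : ∀ᵐ x, κ T * barrier q R x ≤ U i T x := by
    refine barrier_le_of_comparison (t₀ := T - 1 / 2) (V := V i) (A := A i) hq hR (by linarith)
      ((h.continuousOn i).mono (Icc_subset_Ici_self.trans (Ici_subset_Ici.2 (by linarith))))
      (fun r hr => h.hasDerivAt i r (by linarith [hr.1])) hκd (by rw [hκ]; simp)
      (h0 i _ (by linarith)) fun s hs => ?_
    have hs0 : 0 < s := by linarith [hs.1]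
    have hκnn : 0 ≤ κ s := mul_nonneg (by positivity) (by linarith [hs.1])
    have hκle : κ s ≤ κ₀ * ω / 2 := by
      have : κ s ≤ κ₀ * ω * (1 / 2) :=
        mul_le_mul_of_nonneg_left (by linarith [hs.2]) (by positivity)
      linarith
    have hp : MemLp (fun x => max (κ s * barrier q R x - U i s x) 0) 2 volume :=
      (((memLp_barrier hq hR).const_mul (κ s)).sub (Lp.memLp (U i s))).pos_part
    have hpb : Integrable (fun x => max (κ s * barrier q R x - U i s x) 0 * barrier q R x) volume :=
      hp.integrable_mul (memLp_barrier hq hR)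
    have hPnn := integral_posPart_mul_barrier_nonneg (q := q) hR0
      (fun x => κ s * barrier q R x - U i s x)
    have h1 := H (U i s) (A i s) (h.fracLaplacian i s hs0) R (κ s) hR hκnn
    have e1 : ∀ x : EuclideanSpace ℝ (Fin d), max (κ s * barrier q R x - U i s x) 0 *
        (κ s * barrier q R x) = κ s * (max (κ s * barrier q R x - U i s x) 0 * barrier q R x) :=
      fun x => by ring
    have h2 : ∫ x, (c * ω / 2 - L * κ s) *
          (max (κ s * barrier q R x - U i s x) 0 * barrier q R x)
        ≤ ∫ x, max (κ s * barrier q R x - U i s x) 0 * (V i s x + A i s x) := by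
      refine integral_mono_ae (hpb.const_mul _)
        (hp.integrable_mul ((Lp.memLp (V i s)).add (Lp.memLp (A i s)))) ?_
      filter_upwards [h.eq i s hs0, IsStrongSolution.ae_nonneg_pi h0 hs0.le,
        hsrc s (Ioo_subset_Icc_self hs)] with x hx hx0 hxs
      rw [hx]
      rcases le_total (κ s * barrier q R x - U i s x) 0 with hle | hle
      · rw [max_eq_right hle]
        simp
      · rw [max_eq_left hle]
        have hb := (barrier_pos q hR0 x).le
        have hUx : U i s x ≤ κ s * barrier q R x := by linarith
        have h3 := half_le_trunc hΛ (mul_nonneg hω hb)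
          ((mul_le_of_le_one_right hω (barrier_le_one hq0 hR x)).trans hωΛ) hxs
        have h4 := mul_le_mul_of_nonneg_left h3 hc.le
        have h5 := mul_le_mul_of_nonneg_left hUx hL
        have h6 := hcf _ hx0
        have h7 : (c * ω / 2 - L * κ s) * barrier q R x ≤ f i fun j => U j s x := by
          linarith
        linarith [mul_le_mul_of_nonneg_left h7 hle]
    rw [integral_const_mul] at h2
    simp only [e1] at h1
    rw [integral_const_mul] at h1
    set P : ℝ := ∫ x, max (κ s * barrier q R x - U i s x) 0 * barrier q R x with hP
    have h8 : κ₀ * ω + (K + L) * κ s ≤ c * ω / 2 := by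
      have h9 := mul_le_mul_of_nonneg_left hκle (add_nonneg hK hL)
      have h10 : κ₀ * ω + (K + L) * (κ₀ * ω / 2) = c * ω / 2 := by
        rw [← hκ₀e]
        ring
      linarith
    have h11 := mul_le_mul_of_nonneg_right h8 hPnn
    linarith
  have hκT : κ T = κ₀ / 2 * ω := by
    rw [hκ]
    ring
  rwa [hκT] at hcomp

end System

end

/-! ### The lower bound for all components. -/

theorem lemma4 (d m : ℕ) (hd : 1 ≤ d) (hm : 1 ≤ m)
    -- the orders of the fractional Laplacians: nonincreasing, the last (smallest) one is `< 1`
    (α : Fin m → ℝ) (hα : ∀ i, 0 < α i ∧ α i ≤ 1) (hα_anti : Antitone α)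
    (last : Fin m) (hlast : (last : ℕ) = m - 1) (hα_last : α last < 1)
    -- the cooperative reaction term
    (f : Fin m → (Fin m → ℝ) → ℝ) (hf_zero : ∀ i, f i 0 = 0)
    (hf_C1 : ∀ i, ContDiff ℝ 1 (f i))
    (hf_coop : ∀ i j, j ≠ i → ∀ s, 0 < partialD j (f i) s)
    -- positive principal eigenvalue of `DF(0)`
    (hH1 : ∃ l : ℝ, 0 < l ∧ IsPrincipalEigenvalue (jacobian f 0) l)
    -- dissipativity for large densities
    (Λ : ℝ) (hΛ : 1 < Λ) (hH2 : ∀ i, ∀ s : Fin m → ℝ, (∀ j, Λ ≤ s j) → f i s ≤ 0)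
    -- `F` is globally Lipschitz
    (hH5 : ∃ L : NNReal, LipschitzWith L (fun (s : Fin m → ℝ) (i : Fin m) => f i s))
    -- `γ = γ_mm` bounds `|∂_m f_m|` on the box `[0, Λ]^m`
    (γ : ℝ) (hγ_pos : 0 < γ)
    (hγ : ∀ s ∈ Set.Icc (0 : Fin m → ℝ) (fun _ => Λ), |partialD last (f last) s| ≤ γ)
    -- the initial condition
    (u₀ : Fin m → EuclideanSpace ℝ (Fin d) → ℝ)
    (hu₀_cont : ∀ i, Continuous (u₀ i)) (hu₀_nonneg : ∀ i x, 0 ≤ u₀ i x)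
    (hu₀_ne : ∃ i x, u₀ i x ≠ 0)
    (hu₀_decay : ∀ i, Asymptotics.IsBigO (Filter.cocompact (EuclideanSpace ℝ (Fin d)))
      (u₀ i) (fun x => ‖x‖ ^ (-((d : ℝ) + 2 * α i))))
    -- the solution
    (u : Fin m → ℝ → EuclideanSpace ℝ (Fin d) → ℝ) (hu : IsSolution α f u₀ u) :
    ∃ c : ℝ, 0 < c ∧ ∀ i : Fin m, ∀ x : EuclideanSpace ℝ (Fin d), ∀ t : ℝ, 1 ≤ t →
      c * t * Real.exp (-γ * t) /
          (t ^ ((d : ℝ) / (2 * α last) + 1) + ‖x‖ ^ ((d : ℝ) + 2 * α last))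
        ≤ u i t x := by
  obtain ⟨L, hL⟩ := hH5
  obtain ⟨U, V, A, hUu, hUc, -, -, hUd, hUA, heq⟩ := hu.strong
  have hΛ0 : 0 < Λ := by linarith
  have ha := (hα last).1
  have hf : IsCooperative f L := by
    refine ⟨hf_zero, hf_C1, hf_coop, L.coe_nonneg, fun i s s' => ?_⟩
    have h1 := hL.dist_le_mul s s'
    rw [dist_eq_norm s s'] at h1
    exact (dist_le_pi_dist (fun i => f i s) (fun i => f i s') i).trans h1
  have hS : IsStrongSolution α f U V A := by
    refine ⟨hUc, hUd, hUA, fun i t ht => ?_⟩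
    filter_upwards [heq i t ht, ae_all_iff.2 fun j => hUu j t ht.le] with x hx hx2
    rw [hx]
    simp only [hx2]
  have hU0 : ∀ i, U i 0 =ᵐ[volume] u₀ i := fun i => by
    have := hUu i 0 le_rfl
    rwa [hu.initial i] at this
  have h0 : ∀ i, ∀ s, 0 ≤ s → ∀ᵐ x, 0 ≤ U i s x := fun i s hs =>
    hS.nonneg hd hα hf (fun j => by
      filter_upwards [hU0 j] with x hx
      rw [hx]
      exact hu₀_nonneg j x) hs i
  obtain ⟨i₀, x₀, hx₀⟩ := hu₀_ne
  have hne : ¬ ∀ᵐ x, U i₀ 0 x = 0 := by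
    intro hz
    have h1 : u₀ i₀ =ᵐ[volume] fun _ => (0 : ℝ) := by
      filter_upwards [hU0 i₀, hz] with x h1 h2
      rw [← h1, h2]
    exact hx₀ (congrFun (Continuous.ae_eq_iff_eq volume (hu₀_cont i₀) continuous_const |>.1 h1) x₀)
  set q : ℝ := (d : ℝ) + 2 * α last with hqd
  have hq : (d : ℝ) < q := by linarith
  have hq0 : 0 ≤ q := by positivity
  obtain ⟨c₀, hc₀, H₀⟩ := hS.exists_barrier_le_last hd hα h0 hΛ0 hγ_pos hα_last
    (fun s hs hsΛ => hf.neg_mul_le_of_le hγ hs hsΛ)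
    (hS.mass_pos hd hα hf h0 hΛ0 hq hne last (by norm_num))
  rw [← hqd] at H₀
  have hex : ∀ i, ∃ c, 0 < c ∧ ∀ T, 1 ≤ T → ∀ᵐ x,
      c * T * Real.exp (-γ * T) * barrier q (T ^ (1 / (2 * α last))) x ≤ U i T x := by
    intro i
    rcases eq_or_ne last i with rfl | hi
    · exact ⟨c₀, hc₀, fun T hT => (H₀ T hT).2 T ⟨by linarith, le_rfl⟩⟩
    · obtain ⟨c₁, hc₁, H₁⟩ := hS.exists_barrier_le_of_source hd hα hf h0 hΛ0 hq hi
      refine ⟨c₁ * c₀, by positivity, fun T hT => ?_⟩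
      have h1 := H₁ T (T ^ (1 / (2 * α last))) (c₀ * T * Real.exp (-γ * T)) hT
        (Real.one_le_rpow hT (by positivity)) (by positivity) (H₀ T hT).1 (H₀ T hT).2
      filter_upwards [h1] with x hx
      linarith
  choose c hc hcU using hex
  have : Nonempty (Fin m) := ⟨last⟩
  obtain ⟨i₁, hi₁⟩ := Finite.exists_min c
  refine ⟨c i₁ * 2 ^ (-q / 2), mul_pos (hc i₁) (by positivity), fun i x t ht => ?_⟩
  have ht0 : 0 < t := by linarith
  set R : ℝ := t ^ (1 / (2 * α last)) with hR
  have hR0 : 0 < R := Real.rpow_pos_of_pos ht0 _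
  -- The inequality holds almost everywhere, hence on a dense set, and it is closed because both
  -- sides are continuous.
  have hall : ∀ y, c i * t * Real.exp (-γ * t) * barrier q R y ≤ u i t y := by
    have hcont : Continuous fun y : EuclideanSpace ℝ (Fin d) =>
        c i * t * Real.exp (-γ * t) * barrier q R y := continuous_const.mul (continuous_barrier q hR0)
    have hclosed : IsClosed {y | c i * t * Real.exp (-γ * t) * barrier q R y ≤ u i t y} :=
      isClosed_le hcont (hu.continuous_space i t ht0.le)
    have hae : ∀ᵐ y, y ∈ {y | c i * t * Real.exp (-γ * t) * barrier q R y ≤ u i t y} := by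
      filter_upwards [hcU i t ht, hUu i t ht0.le] with y h1 h2
      rw [← h2] at *
      exact h1
    have hdense := Measure.dense_of_ae hae
    intro y
    have := hclosed.closure_eq ▸ hdense y
    exact this
  have hRq : t ^ ((d : ℝ) / (2 * α last) + 1) = R ^ q := by
    rw [hR, ← Real.rpow_mul ht0.le]
    congr 1
    rw [hqd]
    field_simp
  rw [hRq]
  calc c i₁ * 2 ^ (-q / 2) * t * Real.exp (-γ * t) / (R ^ q + ‖x‖ ^ q)
      = c i₁ * t * Real.exp (-γ * t) * (2 ^ (-q / 2) / (R ^ q + ‖x‖ ^ q)) := by ring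
    _ ≤ c i * t * Real.exp (-γ * t) * barrier q R x := by
        have h1 := inv_le_barrier hq0 hR0 x
        have h2 := hi₁ i
        have h3 := (barrier_pos q hR0 x).le
        have h4 := (hc i₁).le
        gcongr
        exact mul_nonneg (mul_nonneg (hc i).le ht0.le) (Real.exp_pos _).le
    _ ≤ u i t x := hall x
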